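/- Let $M$ be a smooth (Hausdorff) $m$-dimensional manifold, let $\mathbf{T}M=TM\oplus T^*M$ with the neutral metric $g((X,\alpha),(Y,\mu))=\alpha(Y)+\mu(X)$ and the Courant bracket $$[(X,\alpha),(Y,\mu)]=\big([X,Y],\,L_X\mu-L_Y\alpha+\tfrac12 d(\alpha(Y)-\mu(X))\big).$$ A generalized Riemannian metric $G$ on $M$ is given by a smooth endomorphism $\phi$ of $\mathbf{T}M$ with $\phi^2=\mathrm{Id}$ and $g(\phi\mathcal X,\phi\mathcal Y)=g(\mathcal X,\mathcal Y)$ such that $G(\mathcal X,\mathcal Y)=g(\phi\mathcal X,\mathcal Y)$ is positive definite. It is equivalent to the pair $(\gamma,\psi)$ of a Riemannian metric $\gamma$ and a $2$-form $\psi$ on $M$ for which the $\pm1$-eigenbundles of $\phi$ are $V_\pm=\{(X,\flat_{\psi\pm\gamma}X) : X\in TM\}$, where $\flat_{\psi\pm\gamma}X=\psi(X,\cdot)\pm\gamma(X,\cdot)$. Let $D$ be the Levi-Civita connection of $\gamma$ and let $\sharp_\gamma:T^*M\to TM$ be the inverse of $X\mapsto\gamma(X,\cdot)$. The canonical big connection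 $\nabla$ of $G$ is the connection on $\mathbf{T}M$ defined by $$\nabla_X(Y,\flat_{\psi\pm\gamma}Y)=(D^\pm_XY,\flat_{\psi\pm\gamma}D^\pm_XY),\qquad D^\pm_XY=D_XY\pm\tfrac12\sharp_\gamma\big(d\psi(X,Y,\cdot)\big).$$ Let $\Psi$ be a smooth endomorphism of $\mathbf{T}M$ such that $(G,\Psi)$ is an almost generalized para-Hermitian structure, i.e. $\Psi^2=\mathrm{Id}$, $g(\mathcal X,\Psi\mathcal Y)+g(\Psi\mathcal X,\mathcal Y)=0$ and $G(\Psi\mathcal X,\Psi\mathcal Y)=G(\mathcal X,\mathcal Y)$. Then $\Psi(X,\flat_{\psi+\gamma}X)=(FX,\flat_{\psi-\gamma}FX)$ for a unique $\gamma$-isometry $F$ of $TM$. The structure $(G,\Psi)$ is called parallel if $\Psi$ is integrable, i.e. $$[\Psi\mathcal X,\Psi\mathcal Y]-\Psi[\mathcal X,\Psi\mathcal Y]-\Psi[\Psi\mathcal X,\mathcal Y]+\Psi^2[\mathcal X,\mathcal Y]=0$$ for all smooth sections $\mathcal X,\mathcal Y$ of $\mathbf{T}M$, and $\Psi$ commutes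 with $\nabla$, i.e. $\nabla_X(\Psi\mathcal Y)=\Psi(\nabla_X\mathcal Y)$ for all smooth vector fields $X$ and smooth sections $\mathcal Y$ of $\mathbf{T}M$. **Proposition 3.3.** The almost generalized para-Hermitian structure $(G,\Psi)$ is parallel if and only if $d\psi=0$ and $F$ is parallel with respect to the Levi-Civita connection $D$ of $\gamma$, i.e. $D_X(FY)=F(D_XY)$ for all smooth vector fields $X,Y$. -/

import Mathlib

open Bundle
open scoped Manifold ContDiff

noncomputable section

namespace GeneralizedGeometry

section Basic

variable (E : Type*) [NormedAddCommGroup E] [NormedSpace ℝ E]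
  {M : Type*} [TopologicalSpace M] [ChartedSpace E M]

/-- The tangent space `T_xM` of a boundaryless manifold modelled on `E`. -/
abbrev Tg (x : M) : Type _ := TangentSpace 𝓘(ℝ, E) x

/-- The cotangent space `T*_xM`. -/
abbrev Cotg (x : M) : Type _ := Tg E x →L[ℝ] ℝ

/-- The fibre `T_xM ⊕ T*_xM` of the big tangent bundle. -/
abbrev BigTg (x : M) : Type _ := Tg E x × Cotg E x

variable {E}

/-- The neutral metric `g((X,α),(Y,μ)) = α(Y) + μ(X)`. -/
def neutral {x : M} (u v : BigTg E x) : ℝ := u.2 v.1 + v.2 u.1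

variable [IsManifold 𝓘(ℝ, E) ∞ M]

/-- `X` is a smooth vector field. -/
def SmoothField (X : Π x : M, Tg E x) : Prop :=
  ContMDiff 𝓘(ℝ, E) (𝓘(ℝ, E).prod 𝓘(ℝ, E)) ∞ (fun x => TotalSpace.mk' E x (X x))

/-- `𝒳` is a smooth section of the vector bundle `TM ⊕ T*M`. -/
def SmoothBigField (𝒳 : Π x : M, BigTg E x) : Prop :=
  ContMDiff 𝓘(ℝ, E) (𝓘(ℝ, E).prod 𝓘(ℝ, E × (E →L[ℝ] ℝ))) ∞
    (fun x => TotalSpace.mk' (E × (E →L[ℝ] ℝ)) x (𝒳 x))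

/-- `A` is a smooth endomorphism of the vector bundle `TM ⊕ T*M`, i.e. a smooth section of the
corresponding bundle of homomorphisms. -/
def SmoothBigEnd (A : Π x : M, BigTg E x →L[ℝ] BigTg E x) : Prop :=
  ContMDiff 𝓘(ℝ, E)
    (𝓘(ℝ, E).prod 𝓘(ℝ, (E × (E →L[ℝ] ℝ)) →L[ℝ] (E × (E →L[ℝ] ℝ)))) ∞
    (fun x => TotalSpace.mk' ((E × (E →L[ℝ] ℝ)) →L[ℝ] (E × (E →L[ℝ] ℝ))) x (A x))

end Basic

section Calculus

variable {E : Type*} [NormedAddCommGroup E] [NormedSpace ℝ E] [FiniteDimensional ℝ E]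
  {M : Type*} [TopologicalSpace M] [ChartedSpace E M] [IsManifold 𝓘(ℝ, E) ∞ M]

/-- The derivative `X(f)` at the point `x` of a function `f` along a vector field `X`. -/
def dirDeriv (X : Π x : M, Tg E x) (f : M → ℝ) (x : M) : ℝ :=
  mvfderiv 𝓘(ℝ, E) f x (X x)

/-- The Lie bracket of vector fields. -/
def lie (X Y : Π x : M, Tg E x) : Π x : M, Tg E x :=
  VectorField.mlieBracket 𝓘(ℝ, E) X Y

open Classical in
/-- The covector at `x` defined by an operation `Φ` on vector fields that is tensorial
(`C^∞`-linear) at `x`; it sends `Z_x` to `Φ Z`. (All operations used below are tensorial when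
the fields they involve are differentiable; the value is `0` by convention otherwise.) -/
def covector (Φ : (Π y : M, Tg E y) → ℝ) (x : M) : Cotg E x :=
  if h : TensorialAt 𝓘(ℝ, E) E Φ x then TensorialAt.mkHom Φ x h else 0

theorem covector_apply {Φ : (Π y : M, Tg E y) → ℝ} {x : M}
    (h : TensorialAt 𝓘(ℝ, E) E Φ x) {Z : Π y : M, Tg E y}
    (hZ : MDiffAt (fun y => TotalSpace.mk' E y (Z y)) x) : covector Φ x (Z x) = Φ Z := by
  rw [covector, dif_pos h]
  exact TensorialAt.mkHom_apply h hZ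

/-- The Lie derivative of a 1-form, `(L_X μ)(Z) = X(μ(Z)) - μ([X,Z])`. -/
def lieDerivForm (X : Π x : M, Tg E x) (μ : Π x : M, Cotg E x) (x : M) : Cotg E x :=
  covector (fun Z => dirDeriv X (fun y => μ y (Z y)) x - μ x (lie X Z x)) x

/-- The Courant bracket
`[(X,α),(Y,μ)] = ([X,Y], L_X μ - L_Y α + (1/2) d(α(Y) - μ(X)))`. -/
def courant (𝒳 𝒴 : Π x : M, BigTg E x) (x : M) : BigTg E x :=
  (lie (fun y => (𝒳 y).1) (fun y => (𝒴 y).1) x,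
    lieDerivForm (fun y => (𝒳 y).1) (fun y => (𝒴 y).2) x
      - lieDerivForm (fun y => (𝒴 y).1) (fun y => (𝒳 y).2) x
      + (1 / 2 : ℝ) • mvfderiv 𝓘(ℝ, E) (fun y => (𝒳 y).2 (𝒴 y).1 - (𝒴 y).2 (𝒳 y).1) x)

/-- The Courant-Nijenhuis torsion
`[Ψ𝒳,Ψ𝒴] - Ψ[𝒳,Ψ𝒴] - Ψ[Ψ𝒳,𝒴] + Ψ²[𝒳,𝒴]` of an endomorphism `Ψ` of `TM ⊕ T*M`. -/
def nijenhuis (Ψ : Π x : M, BigTg E x →L[ℝ] BigTg E x) (𝒳 𝒴 : Π x : M, BigTg E x)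
    (x : M) : BigTg E x :=
  courant (fun y => Ψ y (𝒳 y)) (fun y => Ψ y (𝒴 y)) x
    - Ψ x (courant 𝒳 (fun y => Ψ y (𝒴 y)) x)
    - Ψ x (courant (fun y => Ψ y (𝒳 y)) 𝒴 x)
    + Ψ x (Ψ x (courant 𝒳 𝒴 x))

/-- The exterior derivative of a 2-form `ψ`, evaluated on vector fields at the point `x`. -/
def dTwoForm (ψ : Π x : M, Tg E x →L[ℝ] Cotg E x) (X Y Z : Π x : M, Tg E x) (x : M) : ℝ :=
  dirDeriv X (fun y => ψ y (Y y) (Z y)) x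
    - dirDeriv Y (fun y => ψ y (X y) (Z y)) x
    + dirDeriv Z (fun y => ψ y (X y) (Y y)) x
    - ψ x (lie X Y x) (Z x) + ψ x (lie X Z x) (Y x) - ψ x (lie Y Z x) (X x)

/-- The right-hand side of the Koszul formula for `2γ(D_X Y, Z)`. -/
def koszul (γ : Π x : M, Tg E x →L[ℝ] Cotg E x) (X Y Z : Π x : M, Tg E x) (x : M) : ℝ :=
  dirDeriv X (fun y => γ y (Y y) (Z y)) x
    + dirDeriv Y (fun y => γ y (X y) (Z y)) x
    - dirDeriv Z (fun y => γ y (X y) (Y y)) x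
    + γ x (lie X Y x) (Z x) - γ x (lie X Z x) (Y x) - γ x (lie Y Z x) (X x)

/-- The Levi-Civita connection `D_X Y` of the metric `γ`, given by the Koszul formula; the
metric is written as the map `♭_γ : TM → T*M`, whose inverse is `♯_γ`. -/
def leviCivita (γ : Π x : M, Tg E x →L[ℝ] Cotg E x) (X Y : Π x : M, Tg E x) (x : M) :
    Tg E x :=
  (γ x).inverse ((1 / 2 : ℝ) • covector (fun Z => koszul γ X Y Z x) x)

/-- The connection `D_X Y + (s/2) ♯_γ (i(Y) i(X) dψ)`. For `s = 1` and `s = -1` these are the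
`γ`-metric connections `D^±` with torsion `γ(T(X,Y),Z) = ± dψ(X,Y,Z)`. -/
def torsionConn (s : ℝ) (γ ψ : Π x : M, Tg E x →L[ℝ] Cotg E x) (X Y : Π x : M, Tg E x)
    (x : M) : Tg E x :=
  leviCivita γ X Y x + (s / 2) • (γ x).inverse (covector (fun Z => dTwoForm ψ X Y Z x) x)

theorem covector_zero (x : M) : covector (E := E) (fun _ => 0) x = 0 := by
  have h : TensorialAt 𝓘(ℝ, E) E (fun _ : (Π y : M, Tg E y) => (0 : ℝ)) x := by
    constructor <;> intros <;> simp
  rw [covector, dif_pos h]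
  ext v
  rfl

theorem torsionConn_zero (s : ℝ) (γ ψ : Π x : M, Tg E x →L[ℝ] Cotg E x)
    (X : Π x : M, Tg E x) (x : M) : torsionConn s γ ψ X (fun _ => 0) x = 0 := by
  have hl : ∀ Z : Π x : M, Tg E x, lie (fun _ => 0) Z x = 0 := fun Z => by
    have := congrFun (VectorField.mlieBracket_zero_left (I := 𝓘(ℝ, E)) (W := Z)) x
    exact this
  have hr : lie X (fun _ => 0) x = 0 := by
    have := congrFun (VectorField.mlieBracket_zero_right (I := 𝓘(ℝ, E)) (W := X)) x
    exact this
  have h0 : ∀ Z : Π x : M, Tg E x, dirDeriv Z (fun _ => (0 : ℝ)) x = 0 := fun Z => by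
    have : mvfderiv 𝓘(ℝ, E) (fun _ : M => (0 : ℝ)) x = 0 := by
      simp [mvfderiv, mfderiv_const]
    rw [dirDeriv, this]
    rfl
  have h0' : ∀ f : M → ℝ, dirDeriv (E := E) (fun _ => 0) f x = 0 := fun f => by
    rw [dirDeriv, map_zero]
  have hk : (fun Z => koszul γ X (fun _ => 0) Z x) = fun _ => 0 := by
    funext Z
    simp [koszul, hl, hr, h0, h0']
  have hd : (fun Z => dTwoForm ψ X (fun _ => 0) Z x) = fun _ => 0 := by
    funext Z
    simp [dTwoForm, hl, hr, h0, h0']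
  rw [torsionConn, leviCivita, hk, hd, covector_zero]
  simp

end Calculus

section Structures

variable (E : Type*) [NormedAddCommGroup E] [NormedSpace ℝ E]
  (M : Type*) [TopologicalSpace M] [ChartedSpace E M] [IsManifold 𝓘(ℝ, E) ∞ M]

/-- A generalized Riemannian metric on `M`: a smooth endomorphism `φ` of `TM ⊕ T*M` with
`φ² = Id` that preserves the neutral metric `g` and for which `G(u,v) = g(φu,v)` is positive
definite. The subbundles `V_±` are the `±1`-eigenbundles of `φ`. -/
structure GenRiemannian where
  φ : Π x : M, BigTg E x →L[ℝ] BigTg E x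
  smooth : SmoothBigEnd φ
  φ_sq : ∀ (x : M) (u : BigTg E x), φ x (φ x u) = u
  φ_neutral : ∀ (x : M) (u v : BigTg E x), neutral (φ x u) (φ x v) = neutral u v
  pos : ∀ (x : M) (u : BigTg E x), u ≠ 0 → 0 < neutral (φ x u) u

variable {E M}

namespace GenRiemannian

variable (G : GenRiemannian E M)

/-- The positive definite metric `G(u,v) = g(φu,v)` on `TM ⊕ T*M`. -/
def metric (x : M) (u v : BigTg E x) : ℝ := neutral (G.φ x u) v

/-- The map `α ↦ pr_{TM} φ(0,α)`. Since `φ(0, ♭_γ X) = (X, ♭_ψ X)`, it is `♯_γ`. -/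
def sharp (x : M) : Cotg E x →L[ℝ] Tg E x :=
  ContinuousLinearMap.fst ℝ (Tg E x) (Cotg E x) ∘L G.φ x ∘L
    ContinuousLinearMap.inr ℝ (Tg E x) (Cotg E x)

/-- The Riemannian metric `γ` of the pair `(γ,ψ)` equivalent to `G`, as the map
`♭_γ : X ↦ γ(X,·)`. -/
def γ (x : M) : Tg E x →L[ℝ] Cotg E x := (G.sharp x).inverse

/-- The 2-form `ψ` of the pair `(γ,ψ)` equivalent to `G`, as the map `♭_ψ : X ↦ ψ(X,·)`. -/
def ψ (x : M) : Tg E x →L[ℝ] Cotg E x :=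
  ContinuousLinearMap.snd ℝ (Tg E x) (Cotg E x) ∘L G.φ x ∘L
    ContinuousLinearMap.inr ℝ (Tg E x) (Cotg E x) ∘L G.γ x

section Lemmas

variable {G} {x : M}

theorem neutral_φ_comm (u v : BigTg E x) :
    neutral (G.φ x u) v = neutral u (G.φ x v) := by
  rw [← G.φ_neutral x u (G.φ x v), G.φ_sq]

theorem sharp_pos {α : Cotg E x} (hα : α ≠ 0) : 0 < α (G.sharp x α) := by
  have := G.pos x (0, α) (by simpa using hα)
  simpa [neutral, sharp] using this

theorem sharp_injective : Function.Injective (G.sharp x) := by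
  refine (injective_iff_map_eq_zero _).2 fun α hα => ?_
  by_contra h
  have := sharp_pos (G := G) h
  simp [hα] at this

variable [FiniteDimensional ℝ E]

theorem sharp_isInvertible : (G.sharp x).IsInvertible := by
  have : FiniteDimensional ℝ (Tg E x) := inferInstanceAs (FiniteDimensional ℝ E)
  have : T2Space (Tg E x) := inferInstanceAs (T2Space E)
  have e1 : Module.finrank ℝ (Cotg E x) = Module.finrank ℝ (Tg E x) := by
    rw [← (LinearMap.toContinuousLinearMap (𝕜 := ℝ) (E := Tg E x) (F' := ℝ)).finrank_eq]
    exact Subspace.dual_finrank_eq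
  have : FiniteDimensional ℝ (Cotg E x) :=
    (LinearMap.toContinuousLinearMap (𝕜 := ℝ) (E := Tg E x) (F' := ℝ)).finiteDimensional
  let e : Cotg E x ≃ₗ[ℝ] Tg E x :=
    LinearEquiv.ofInjectiveOfFinrankEq (G.sharp x).toLinearMap sharp_injective e1
  refine ⟨e.toContinuousLinearEquiv, ?_⟩
  ext α
  rfl

theorem γ_sharp (α : Cotg E x) : G.γ x (G.sharp x α) = α := by
  rw [γ, (sharp_isInvertible (G := G)).inverse_apply_eq]

theorem sharp_γ (X : Tg E x) : G.sharp x (G.γ x X) = X := by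
  have := (sharp_isInvertible (G := G) (x := x)).inverse_apply_eq (y := X)
    (x := G.γ x X)
  exact (this.1 rfl).symm

/-- `♯_γ` is the inverse of `♭_γ`. -/
theorem γ_inverse : (G.γ x).inverse = G.sharp x := by
  refine ContinuousLinearMap.inverse_eq ?_ ?_ <;> ext1 u
  · exact γ_sharp u
  · exact sharp_γ u

theorem φ_zero_γ (X : Tg E x) : G.φ x (0, G.γ x X) = (X, G.ψ x X) := by
  refine Prod.ext ?_ rfl
  exact sharp_γ X

theorem φ_graph (X : Tg E x) : G.φ x (X, G.ψ x X) = (0, G.γ x X) := by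
  rw [← φ_zero_γ, G.φ_sq]

theorem γ_symm (X Y : Tg E x) : G.γ x X Y = G.γ x Y X := by
  have := neutral_φ_comm (G := G) (x := x) (0, G.γ x X) (0, G.γ x Y)
  rw [φ_zero_γ, φ_zero_γ] at this
  simp [neutral] at this
  exact this.symm

theorem γ_pos {X : Tg E x} (hX : X ≠ 0) : 0 < G.γ x X X := by
  have h : G.γ x X ≠ 0 := by
    intro h
    apply hX
    rw [← sharp_γ (G := G) X, h, map_zero]
  simpa [sharp_γ] using sharp_pos (G := G) h

theorem ψ_skew (X Y : Tg E x) : G.ψ x X Y = -G.ψ x Y X := by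
  have := G.φ_neutral x (0, G.γ x X) (0, G.γ x Y)
  rw [φ_zero_γ, φ_zero_γ] at this
  simp [neutral] at this
  linarith

theorem φ_apply (u : BigTg E x) :
    G.φ x u = (G.sharp x (u.2 - G.ψ x u.1),
      G.γ x u.1 + G.ψ x (G.sharp x (u.2 - G.ψ x u.1))) := by
  have key : G.φ x (0, u.2 - G.ψ x u.1)
      = (G.sharp x (u.2 - G.ψ x u.1), G.ψ x (G.sharp x (u.2 - G.ψ x u.1))) := by
    rw [← φ_zero_γ, γ_sharp]
  have hu : u = (u.1, G.ψ x u.1) + (0, u.2 - G.ψ x u.1) := by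
    refine Prod.ext ?_ ?_
    · exact (add_zero _).symm
    · exact (add_sub_cancel _ _).symm
  calc G.φ x u = G.φ x ((u.1, G.ψ x u.1) + (0, u.2 - G.ψ x u.1)) := by rw [← hu]
    _ = G.φ x (u.1, G.ψ x u.1) + G.φ x (0, u.2 - G.ψ x u.1) :=
      ContinuousLinearMap.map_add _ _ _
    _ = _ := by
      rw [φ_graph, key]
      exact Prod.ext (zero_add _) rfl

/-- `V_+` is the set of the vectors `(X, ♭_{ψ+γ}X)`. -/
theorem mem_Vplus_iff (u : BigTg E x) :
    G.φ x u = u ↔ u.2 = G.ψ x u.1 + G.γ x u.1 := by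
  rw [φ_apply]
  constructor
  · intro h
    have h1 : G.sharp x (u.2 - G.ψ x u.1) = u.1 := (Prod.ext_iff.1 h).1
    rw [← sub_eq_iff_eq_add', ← γ_sharp (G := G) (u.2 - G.ψ x u.1), h1]
  · intro h
    have h2 : u.2 - G.ψ x u.1 = G.γ x u.1 := sub_eq_iff_eq_add'.2 h
    rw [h2, sharp_γ]
    exact Prod.ext rfl ((add_comm _ _).trans h.symm)

/-- `V_-` is the set of the vectors `(X, ♭_{ψ-γ}X)`. -/
theorem mem_Vminus_iff (u : BigTg E x) :
    G.φ x u = -u ↔ u.2 = G.ψ x u.1 - G.γ x u.1 := by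
  rw [φ_apply]
  constructor
  · intro h
    have h1 : G.sharp x (u.2 - G.ψ x u.1) = -u.1 := (Prod.ext_iff.1 h).1
    have h2 : u.2 - G.ψ x u.1 = -G.γ x u.1 := by
      rw [← γ_sharp (G := G) (u.2 - G.ψ x u.1), h1, ContinuousLinearMap.map_neg]
    rw [sub_eq_iff_eq_add'.1 h2, sub_eq_add_neg]
  · intro h
    have h2 : u.2 - G.ψ x u.1 = -G.γ x u.1 := by rw [h]; abel
    rw [h2, ContinuousLinearMap.map_neg, sharp_γ, ContinuousLinearMap.map_neg]
    refine Prod.ext rfl ?_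
    change G.γ x u.1 + -G.ψ x u.1 = -u.2
    rw [h]; abel

end Lemmas

variable [FiniteDimensional ℝ E]

/-- The canonical big connection: `∇_X (Y, ♭_{ψ±γ}Y) = (D^±_X Y, ♭_{ψ±γ} D^±_X Y)`, extended
to all sections through the projections `(1/2)(Id ± φ)` onto `V_±`. -/
def canonicalConn (X : Π x : M, Tg E x) (𝒴 : Π x : M, BigTg E x) (x : M) : BigTg E x :=
  let Dp := torsionConn 1 G.γ G.ψ X (fun y => ((1 / 2 : ℝ) • (𝒴 y + G.φ y (𝒴 y))).1) x
  let Dm := torsionConn (-1) G.γ G.ψ X (fun y => ((1 / 2 : ℝ) • (𝒴 y - G.φ y (𝒴 y))).1) x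
  (Dp, G.ψ x Dp + G.γ x Dp) + (Dm, G.ψ x Dm - G.γ x Dm)

/-- `∇_X (Y, ♭_{ψ+γ}Y) = (D^+_X Y, ♭_{ψ+γ} D^+_X Y)`. -/
theorem canonicalConn_plus (X Y : Π x : M, Tg E x) (x : M) :
    G.canonicalConn X (fun y => (Y y, G.ψ y (Y y) + G.γ y (Y y))) x =
      (torsionConn 1 G.γ G.ψ X Y x, G.ψ x (torsionConn 1 G.γ G.ψ X Y x)
        + G.γ x (torsionConn 1 G.γ G.ψ X Y x)) := by
  have h : ∀ y, G.φ y (Y y, G.ψ y (Y y) + G.γ y (Y y)) = (Y y, G.ψ y (Y y) + G.γ y (Y y)) :=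
    fun y => (mem_Vplus_iff _).2 rfl
  have h1 : ∀ y, (1 / 2 : ℝ) • (Y y + Y y) = Y y := fun y => by
    rw [← two_smul ℝ, smul_smul]; norm_num
  simp [canonicalConn, h, torsionConn_zero, -one_div, h1]

/-- `∇_X (Y, ♭_{ψ-γ}Y) = (D^-_X Y, ♭_{ψ-γ} D^-_X Y)`. -/
theorem canonicalConn_minus (X Y : Π x : M, Tg E x) (x : M) :
    G.canonicalConn X (fun y => (Y y, G.ψ y (Y y) - G.γ y (Y y))) x =
      (torsionConn (-1) G.γ G.ψ X Y x, G.ψ x (torsionConn (-1) G.γ G.ψ X Y x)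
        - G.γ x (torsionConn (-1) G.γ G.ψ X Y x)) := by
  have h : ∀ y, G.φ y (Y y, G.ψ y (Y y) - G.γ y (Y y)) = -(Y y, G.ψ y (Y y) - G.γ y (Y y)) :=
    fun y => (mem_Vminus_iff _).2 rfl
  have h1 : ∀ y, (1 / 2 : ℝ) • (Y y + Y y) = Y y := fun y => by
    rw [← two_smul ℝ, smul_smul]; norm_num
  simp [canonicalConn, h, torsionConn_zero, -one_div, h1]
end GenRiemannian

/-- An almost generalized para-Hermitian structure `(G,Ψ)`: a smooth, `g`-skew endomorphism `Ψ`
of `TM ⊕ T*M` with `Ψ² = Id` that is compatible with `G`, i.e. `G(Ψu,Ψv) = G(u,v)`. -/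
structure AlmostParaHermitian (G : GenRiemannian E M) where
  Ψ : Π x : M, BigTg E x →L[ℝ] BigTg E x
  smooth : SmoothBigEnd Ψ
  Ψ_sq : ∀ (x : M) (u : BigTg E x), Ψ x (Ψ x u) = u
  skew : ∀ (x : M) (u v : BigTg E x), neutral u (Ψ x v) + neutral (Ψ x u) v = 0
  compat : ∀ (x : M) (u v : BigTg E x), G.metric x (Ψ x u) (Ψ x v) = G.metric x u v

namespace AlmostParaHermitian

variable {G : GenRiemannian E M} (P : AlmostParaHermitian G)

/-- The endomorphism `F` of `TM` that defines `Ψ`: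
`Ψ(X, ♭_{ψ+γ}X) = (FX, ♭_{ψ-γ}FX)`. -/
def F (x : M) : Tg E x →L[ℝ] Tg E x :=
  ContinuousLinearMap.fst ℝ (Tg E x) (Cotg E x) ∘L P.Ψ x ∘L
    (ContinuousLinearMap.id ℝ (Tg E x)).prod (G.ψ x + G.γ x)

section Lemmas

variable {P} {x : M}

theorem φ_Ψ (u : BigTg E x) : G.φ x (P.Ψ x u) = -P.Ψ x (G.φ x u) := by
  have nondeg : ∀ w : BigTg E x, (∀ v : BigTg E x, neutral w v = 0) → w = 0 := by
    intro w hw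
    by_contra h
    have h1 := G.pos x w h
    rw [GenRiemannian.neutral_φ_comm, hw] at h1
    exact lt_irrefl _ h1
  have hsub : ∀ a b v : BigTg E x, neutral (a + b) v = neutral a v + neutral b v := by
    intro a b v
    simp [neutral]; ring
  rw [eq_neg_iff_add_eq_zero]
  refine nondeg _ fun v => ?_
  have h1 := P.compat x u (P.Ψ x v)
  rw [P.Ψ_sq] at h1
  have h2 := P.skew x (G.φ x u) v
  simp only [GenRiemannian.metric] at h1
  rw [hsub, h1]
  exact h2

variable [FiniteDimensional ℝ E]

theorem Ψ_graph (X : Tg E x) :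
    P.Ψ x (X, G.ψ x X + G.γ x X) = (P.F x X, G.ψ x (P.F x X) - G.γ x (P.F x X)) := by
  have h1 : G.φ x (X, G.ψ x X + G.γ x X) = (X, G.ψ x X + G.γ x X) :=
    (GenRiemannian.mem_Vplus_iff _).2 rfl
  have h2 := φ_Ψ (P := P) (X, G.ψ x X + G.γ x X)
  rw [h1] at h2
  exact Prod.ext rfl ((GenRiemannian.mem_Vminus_iff _).1 h2)

/-- `F` is a `γ`-isometry. -/
theorem F_isometry (X Y : Tg E x) : G.γ x (P.F x X) (P.F x Y) = G.γ x X Y := by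
  have h1 : ∀ Z : Tg E x, G.φ x (Z, G.ψ x Z + G.γ x Z) = (Z, G.ψ x Z + G.γ x Z) :=
    fun Z => (GenRiemannian.mem_Vplus_iff _).2 rfl
  have h2 : ∀ Z : Tg E x, G.φ x (Z, G.ψ x Z - G.γ x Z) = -(Z, G.ψ x Z - G.γ x Z) :=
    fun Z => (GenRiemannian.mem_Vminus_iff _).2 rfl
  have h := P.compat x (X, G.ψ x X + G.γ x X) (Y, G.ψ x Y + G.γ x Y)
  rw [GenRiemannian.metric, GenRiemannian.metric, Ψ_graph, Ψ_graph, h1, h2] at h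
  simp only [neutral, Prod.fst_neg, Prod.snd_neg, neg_apply, map_neg,
    add_apply, sub_apply] at h
  have a1 := GenRiemannian.ψ_skew (G := G) X Y
  have a2 := GenRiemannian.ψ_skew (G := G) (P.F x X) (P.F x Y)
  have a3 := GenRiemannian.γ_symm (G := G) X Y
  have a4 := GenRiemannian.γ_symm (G := G) (P.F x X) (P.F x Y)
  linarith

end Lemmas

variable [FiniteDimensional ℝ E]

/-- `Ψ` is integrable: its Courant-Nijenhuis torsion vanishes. -/
def IsIntegrable : Prop :=
  ∀ 𝒳 𝒴 : Π x : M, BigTg E x, SmoothBigField 𝒳 → SmoothBigField 𝒴 →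
    ∀ x : M, nijenhuis P.Ψ 𝒳 𝒴 x = 0

/-- `Ψ` commutes with the canonical big connection of `G`. -/
def CommutesWithCanonicalConn : Prop :=
  ∀ (X : Π x : M, Tg E x) (𝒴 : Π x : M, BigTg E x), SmoothField X → SmoothBigField 𝒴 →
    ∀ x : M, G.canonicalConn X (fun y => P.Ψ y (𝒴 y)) x = P.Ψ x (G.canonicalConn X 𝒴 x)

/-- `(G,Ψ)` is a parallel generalized para-Hermitian structure. -/
def IsParallel : Prop := P.IsIntegrable ∧ P.CommutesWithCanonicalConn

end AlmostParaHermitian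

variable [FiniteDimensional ℝ E]

/-- The 2-form `ψ` is closed: `dψ = 0`. -/
def IsClosedTwoForm (ψ : Π x : M, Tg E x →L[ℝ] Cotg E x) : Prop :=
  ∀ X Y Z : Π x : M, Tg E x, SmoothField X → SmoothField Y → SmoothField Z →
    ∀ x : M, dTwoForm ψ X Y Z x = 0

/-- The endomorphism `F` of `TM` is parallel with respect to the Levi-Civita connection `D` of
`γ`: `D_X (FY) = F (D_X Y)`. -/
def IsLeviCivitaParallel (γ : Π x : M, Tg E x →L[ℝ] Cotg E x)
    (F : Π x : M, Tg E x →L[ℝ] Tg E x) : Prop :=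
  ∀ X Y : Π x : M, Tg E x, SmoothField X → SmoothField Y →
    ∀ x : M, leviCivita γ X (fun y => F y (Y y)) x = F x (leviCivita γ X Y x)

end Structures

end GeneralizedGeometry

end

/-! Use `F` to write every section of `TM ⊕ T*M` as `(X, ♭_{ψ+γ}X) + (FY, ♭_{ψ-γ}FY)`. In the
coordinates `(X, Y)` the endomorphism `Ψ` just swaps the two entries (`Ψ_ofComponents`), so it
commutes with `∇` exactly when `D^-_X(FY) = F(D^+_X Y)` (`commutesWithCanonicalConn_iff`).

Integrability is tested by pairing the torsion with a third section. Since `D` is metric and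
torsion-free, the Courant bracket paired with a section is `dψ` of the three tangent parts plus
terms `γ(D_U V, W)` (`neutral_courant_graph`, `neutral_courant_ofComponents`).

If `Ψ` commutes with `∇`, then `γ(D_X FY, FZ) - γ(D_X Y, Z)` is a combination of values of `dψ`. On
sections of `V_+` the torsion then reduces to `-2 dψ(X,Y,Z)` (`neutral_nijenhuis_plus`).
Integrability therefore forces `dψ = 0`, hence `D^± = D`, and the relation above says that `F` is
parallel.

Conversely, if `dψ = 0` and `DF = 0`, then `D^± = D` gives the commutation. Moreover `F` drops out
of the `γ` terms except in the directions of differentiation, and the four brackets in the torsion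
cancel in pairs (`isIntegrable_of_parallel`). -/

noncomputable section

namespace GeneralizedGeometry

/-! ### Smooth sections and smooth homomorphisms of vector bundles -/

section BundleSections

variable {EB : Type*} [NormedAddCommGroup EB] [NormedSpace ℝ EB]
  {B : Type*} [TopologicalSpace B] [ChartedSpace EB B]
  {F₁ F₂ : Type*} [NormedAddCommGroup F₁] [NormedSpace ℝ F₁]
  [NormedAddCommGroup F₂] [NormedSpace ℝ F₂]
  {V₁ V₂ : B → Type*}
  [∀ x, AddCommGroup (V₁ x)] [∀ x, Module ℝ (V₁ x)] [∀ x, TopologicalSpace (V₁ x)]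
  [TopologicalSpace (TotalSpace F₁ V₁)] [FiberBundle F₁ V₁] [VectorBundle ℝ F₁ V₁]
  [∀ x, AddCommGroup (V₂ x)] [∀ x, Module ℝ (V₂ x)] [∀ x, TopologicalSpace (V₂ x)]
  [TopologicalSpace (TotalSpace F₂ V₂)] [FiberBundle F₂ V₂] [VectorBundle ℝ F₂ V₂]
  {n : WithTop ℕ∞}

omit [∀ x, Module ℝ (V₁ x)] [VectorBundle ℝ F₁ V₁] [∀ x, Module ℝ (V₂ x)]
  [VectorBundle ℝ F₂ V₂] in
/-- A section of the direct sum of two bundles is `C^n` iff both components are. -/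
theorem contMDiffAt_prod_section_iff {s : Π x : B, V₁ x} {t : Π x : B, V₂ x} {x₀ : B} :
    ContMDiffAt 𝓘(ℝ, EB) (𝓘(ℝ, EB).prod 𝓘(ℝ, F₁ × F₂)) n
        (fun x => TotalSpace.mk' (F₁ × F₂) (E := fun x => V₁ x × V₂ x) x (s x, t x)) x₀ ↔
      ContMDiffAt 𝓘(ℝ, EB) (𝓘(ℝ, EB).prod 𝓘(ℝ, F₁)) n (fun x => TotalSpace.mk' F₁ x (s x)) x₀ ∧
      ContMDiffAt 𝓘(ℝ, EB) (𝓘(ℝ, EB).prod 𝓘(ℝ, F₂)) n (fun x => TotalSpace.mk' F₂ x (t x)) x₀ := by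
  rw [contMDiffAt_section, contMDiffAt_section, contMDiffAt_section]
  exact contMDiffAt_prod_module_iff _

/-- In a Hausdorff manifold every vector of a smooth vector bundle is the value of a global smooth
section. -/
theorem exists_contMDiff_section_eq [FiniteDimensional ℝ EB] [T2Space B] [IsManifold 𝓘(ℝ, EB) ∞ B]
    [ContMDiffVectorBundle ∞ F₁ V₁ 𝓘(ℝ, EB)] {x₀ : B} (v : V₁ x₀) :
    ∃ s : Π x : B, V₁ x, ContMDiff 𝓘(ℝ, EB) (𝓘(ℝ, EB).prod 𝓘(ℝ, F₁)) ∞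
      (fun x => TotalSpace.mk' F₁ x (s x)) ∧ s x₀ = v := by
  obtain ⟨u, hu, hs⟩ := FiberBundle.exists_contMDiffOn_extend (k := ∞) 𝓘(ℝ, EB) F₁ v
  -- A bump function equal to `1` at `x₀`, supported where the local extension of `v` is smooth.
  obtain ⟨f, hf⟩ := (SmoothBumpFunction.nhds_basis_tsupport (I := 𝓘(ℝ, EB)) x₀).mem_iff.1
    (interior_mem_nhds.2 hu)
  refine ⟨fun x => f x • FiberBundle.extend F₁ v x, ?_, ?_⟩
  · exact ContMDiffOn.smul_section_of_tsupport (u := interior u) f.contMDiff.contMDiffOn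
      isOpen_interior hf.2 (hs.mono interior_subset)
  · simp

variable [∀ x, IsTopologicalAddGroup (V₂ x)] [∀ x, ContinuousSMul ℝ (V₂ x)]

/-- In a basis of `F₁`, the map `A x` is a finite sum of fixed coordinate functionals times the
vectors `A x (b i)`. -/
theorem contMDiffAt_clm_of_apply [FiniteDimensional ℝ F₁] {A : B → F₁ →L[ℝ] F₂} {x₀ : B}
    (h : ∀ v, ContMDiffAt 𝓘(ℝ, EB) 𝓘(ℝ, F₂) n (fun x => A x v) x₀) :
    ContMDiffAt 𝓘(ℝ, EB) 𝓘(ℝ, F₁ →L[ℝ] F₂) n A x₀ := by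
  let b := Module.finBasis ℝ F₁
  have hA : A = fun x => ∑ i, ContinuousLinearMap.smulRightL ℝ F₁ F₂
      (LinearMap.toContinuousLinearMap (b.coord i)) (A x (b i)) := by
    funext x
    ext v
    conv_lhs => rw [← b.sum_repr v, map_sum]
    simp
  rw [hA]
  exact ContMDiffAt.sum fun i _ => contMDiffAt_const.clm_apply (h (b i))

/-- A family of linear maps between the fibres of two vector bundles is `C^n` if it maps local
frames to `C^n` sections. -/
theorem contMDiffAt_hom_of_apply [FiniteDimensional ℝ F₁] {A : Π x : B, V₁ x →L[ℝ] V₂ x} {x₀ : B}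
    (h : ∀ v : V₁ x₀, ContMDiffAt 𝓘(ℝ, EB) (𝓘(ℝ, EB).prod 𝓘(ℝ, F₂)) n
      (fun x => TotalSpace.mk' F₂ x (A x (FiberBundle.extend F₁ v x))) x₀) :
    ContMDiffAt 𝓘(ℝ, EB) (𝓘(ℝ, EB).prod 𝓘(ℝ, F₁ →L[ℝ] F₂)) n
      (fun x => TotalSpace.mk' (F₁ →L[ℝ] F₂) (E := fun x => V₁ x →L[ℝ] V₂ x) x (A x)) x₀ := by
  rw [contMDiffAt_hom_bundle]
  refine ⟨contMDiffAt_id, contMDiffAt_clm_of_apply fun w => ?_⟩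
  -- The extension of this vector has the constant coordinate `w` near `x₀`, so `h1` is about the
  -- coordinate expression of `A` applied to `w`.
  have h1 := (contMDiffAt_section _).1 (h ((trivializationAt F₁ V₁ x₀).symm x₀ w))
  refine h1.congr_of_eventuallyEq ?_
  have e2 := (trivializationAt F₂ V₂ x₀).open_baseSet.mem_nhds
    (FiberBundle.mem_baseSet_trivializationAt' x₀)
  have e1 := (trivializationAt F₁ V₁ x₀).open_baseSet.mem_nhds
    (FiberBundle.mem_baseSet_trivializationAt' x₀)
  filter_upwards [e1, e2] with x hx' hx
  simp [ContinuousLinearMap.inCoordinates, FiberBundle.extend, hx,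
    FiberBundle.mem_baseSet_trivializationAt' (F := F₁) (E := V₁) x₀,
    Trivialization.apply_mk_symm, Trivialization.symmL_apply, hx']

variable [∀ x, IsTopologicalAddGroup (V₁ x)] [∀ x, ContinuousSMul ℝ (V₁ x)]

/-- The fibrewise inverse of a `C^n` isomorphism of vector bundles is `C^n`. -/
theorem contMDiffAt_hom_inverse [CompleteSpace F₁] {A : Π x : B, V₁ x →L[ℝ] V₂ x} {x₀ : B}
    (hA : ContMDiffAt 𝓘(ℝ, EB) (𝓘(ℝ, EB).prod 𝓘(ℝ, F₁ →L[ℝ] F₂)) n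
      (fun x => TotalSpace.mk' (F₁ →L[ℝ] F₂) (E := fun x => V₁ x →L[ℝ] V₂ x) x (A x)) x₀)
    (hi : ∀ x, (A x).IsInvertible) :
    ContMDiffAt 𝓘(ℝ, EB) (𝓘(ℝ, EB).prod 𝓘(ℝ, F₂ →L[ℝ] F₁)) n
      (fun x => TotalSpace.mk' (F₂ →L[ℝ] F₁) (E := fun x => V₂ x →L[ℝ] V₁ x) x (A x).inverse)
      x₀ := by
  rw [contMDiffAt_hom_bundle] at hA ⊢
  refine ⟨contMDiffAt_id, ?_⟩
  have e1 := (trivializationAt F₁ V₁ x₀).open_baseSet.mem_nhds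
    (FiberBundle.mem_baseSet_trivializationAt' x₀)
  have e2 := (trivializationAt F₂ V₂ x₀).open_baseSet.mem_nhds
    (FiberBundle.mem_baseSet_trivializationAt' x₀)
  -- In trivializations the fibrewise inverse becomes the inverse of the coordinate expression, so
  -- only smoothness of inversion at an invertible operator is needed.
  have key : ∀ x ∈ (trivializationAt F₁ V₁ x₀).baseSet, x ∈ (trivializationAt F₂ V₂ x₀).baseSet →
      ∃ e : F₁ ≃L[ℝ] F₂, ContinuousLinearMap.inCoordinates F₁ V₁ F₂ V₂ x₀ x x₀ x (A x) = e ∧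
        ContinuousLinearMap.inCoordinates F₂ V₂ F₁ V₁ x₀ x x₀ x (A x).inverse = e.symm := by
    intro x h1 h2
    obtain ⟨a, ha⟩ := hi x
    refine ⟨(((trivializationAt F₁ V₁ x₀).continuousLinearEquivAt ℝ x h1).symm.trans a).trans
      ((trivializationAt F₂ V₂ x₀).continuousLinearEquivAt ℝ x h2), ?_, ?_⟩
    · rw [ContinuousLinearMap.inCoordinates_eq h1 h2, ← ha]; rfl
    · rw [ContinuousLinearMap.inCoordinates_eq h2 h1, ← ha, ContinuousLinearMap.inverse_equiv]; rfl
  obtain ⟨e, he, -⟩ := key x₀ (FiberBundle.mem_baseSet_trivializationAt' x₀)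
    (FiberBundle.mem_baseSet_trivializationAt' x₀)
  have hd : ContMDiffAt 𝓘(ℝ, F₁ →L[ℝ] F₂) 𝓘(ℝ, F₂ →L[ℝ] F₁) n ContinuousLinearMap.inverse
      (ContinuousLinearMap.inCoordinates F₁ V₁ F₂ V₂ x₀ x₀ x₀ x₀ (A x₀)) := by
    rw [he]
    exact (contDiffAt_map_inverse e).contMDiffAt
  refine (hd.comp x₀ hA.2).congr_of_eventuallyEq ?_
  filter_upwards [e1, e2] with x h1 h2
  obtain ⟨e, he, he'⟩ := key x h1 h2
  simp only [Function.comp]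
  rw [he', he, ContinuousLinearMap.inverse_equiv]

end BundleSections

/-! ### Smooth fields and forms, and smoothness of `γ` and `ψ` -/

section SmoothFields

variable {E : Type*} [NormedAddCommGroup E] [NormedSpace ℝ E]
  {M : Type*} [TopologicalSpace M] [ChartedSpace E M] [IsManifold 𝓘(ℝ, E) ∞ M]

/-- `α` is a smooth 1-form. -/
def SmoothForm (α : Π x : M, Cotg E x) : Prop :=
  ContMDiff 𝓘(ℝ, E) (𝓘(ℝ, E).prod 𝓘(ℝ, E →L[ℝ] ℝ)) ∞
    (fun x => TotalSpace.mk' (E →L[ℝ] ℝ) x (α x))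

/-- `B` is a smooth bilinear form on `TM`, written as a map `TM → T*M`. -/
def SmoothBilinForm (B : Π x : M, Tg E x →L[ℝ] Cotg E x) : Prop :=
  ContMDiff 𝓘(ℝ, E) (𝓘(ℝ, E).prod 𝓘(ℝ, E →L[ℝ] E →L[ℝ] ℝ)) ∞
    (fun x => TotalSpace.mk' (E →L[ℝ] E →L[ℝ] ℝ) (E := fun x => Tg E x →L[ℝ] Cotg E x) x (B x))

theorem smoothBigField_iff {𝒳 : Π x : M, BigTg E x} :
    SmoothBigField 𝒳 ↔ SmoothField (fun x => (𝒳 x).1) ∧ SmoothForm (fun x => (𝒳 x).2) := by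
  simp only [SmoothBigField, SmoothField, SmoothForm, ContMDiff, ← forall_and]
  exact forall_congr' fun x => contMDiffAt_prod_section_iff (V₁ := fun x => Tg E x)
    (V₂ := fun x => Cotg E x)

theorem SmoothBigEnd.apply {A : Π x : M, BigTg E x →L[ℝ] BigTg E x} (hA : SmoothBigEnd A)
    {𝒳 : Π x : M, BigTg E x} (h : SmoothBigField 𝒳) : SmoothBigField (fun x => A x (𝒳 x)) :=
  ContMDiff.clm_bundle_apply (F₁ := E × (E →L[ℝ] ℝ)) (F₂ := E × (E →L[ℝ] ℝ))
    (E₁ := fun x : M => BigTg E x) (E₂ := fun x : M => BigTg E x) hA h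

theorem SmoothBilinForm.apply {B : Π x : M, Tg E x →L[ℝ] Cotg E x} (hB : SmoothBilinForm B)
    {X : Π x : M, Tg E x} (h : SmoothField X) : SmoothForm (fun x => B x (X x)) :=
  ContMDiff.clm_bundle_apply (F₁ := E) (F₂ := E →L[ℝ] ℝ)
    (E₁ := fun x : M => Tg E x) (E₂ := fun x : M => Cotg E x) hB h

/-- The vector field `X` is differentiable at `x`. -/
abbrev DiffField (X : Π x : M, Tg E x) (x : M) : Prop :=
  MDiffAt (fun y => TotalSpace.mk' E y (X y)) x

theorem SmoothField.diff {X : Π x : M, Tg E x} (h : SmoothField X) (x : M) : DiffField X x :=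
  (h x).mdifferentiableAt (by simp)

theorem SmoothForm.diff_apply {α : Π x : M, Cotg E x} (h : SmoothForm α) {Z : Π x : M, Tg E x}
    {x : M} (hZ : DiffField Z x) : MDiffAt (fun y => α y (Z y)) x := by
  have h1 : MDiffAt (fun y => TotalSpace.mk' (E →L[ℝ] ℝ) y (α y)) x :=
    (h x).mdifferentiableAt (by simp)
  have h2 := MDifferentiableAt.clm_bundle_apply (F₁ := E) (F₂ := ℝ)
    (E₁ := fun x : M => Tg E x) (E₂ := Bundle.Trivial M ℝ) h1 hZ
  exact ((mdifferentiableAt_totalSpace _ _).1 h2).2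

theorem SmoothBilinForm.diff_apply {B : Π x : M, Tg E x →L[ℝ] Cotg E x} (h : SmoothBilinForm B)
    {Y Z : Π x : M, Tg E x} {x : M} (hY : DiffField Y x) (hZ : DiffField Z x) :
    MDiffAt (fun y => B y (Y y) (Z y)) x := by
  have h1 : MDiffAt (fun y => TotalSpace.mk' (E →L[ℝ] E →L[ℝ] ℝ)
      (E := fun x => Tg E x →L[ℝ] Cotg E x) y (B y)) x :=
    (h x).mdifferentiableAt (by simp)
  have h2 := MDifferentiableAt.clm_bundle_apply₂ (F₁ := E) (F₂ := E) (F₃ := ℝ)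
    (E₁ := fun x : M => Tg E x) (E₂ := fun x : M => Tg E x) (E₃ := Bundle.Trivial M ℝ) h1 hY hZ
  exact ((mdifferentiableAt_totalSpace _ _).1 h2).2

theorem SmoothField.add {X Y : Π x : M, Tg E x} (hX : SmoothField X) (hY : SmoothField Y) :
    SmoothField (X + Y) := ContMDiff.add_section hX hY

theorem SmoothField.sub {X Y : Π x : M, Tg E x} (hX : SmoothField X) (hY : SmoothField Y) :
    SmoothField (X - Y) := ContMDiff.sub_section hX hY

theorem SmoothForm.add {α β : Π x : M, Cotg E x} (h : SmoothForm α) (h' : SmoothForm β) :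
    SmoothForm (α + β) := ContMDiff.add_section (V := fun x : M => Cotg E x) h h'

theorem SmoothForm.sub {α β : Π x : M, Cotg E x} (h : SmoothForm α) (h' : SmoothForm β) :
    SmoothForm (α - β) := ContMDiff.sub_section (V := fun x : M => Cotg E x) h h'

theorem smoothField_zero : SmoothField (0 : Π x : M, Tg E x) := contMDiff_zeroSection ℝ _

theorem exists_smoothField_eq [FiniteDimensional ℝ E] [T2Space M] {x : M} (v : Tg E x) :
    ∃ X : Π x : M, Tg E x, SmoothField X ∧ X x = v :=
  exists_contMDiff_section_eq (F₁ := E) (V₁ := fun x : M => Tg E x) v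

namespace GenRiemannian

variable [FiniteDimensional ℝ E] (G : GenRiemannian E M)

-- Stated at a point because it is applied to `FiberBundle.extend`, whose smoothness is only local.
-- Both `♯_γ` and `ψ` are read off from `φ(0, α)`.
omit [FiniteDimensional ℝ E] in
theorem smoothAt_φ_zero {α : Π x : M, Cotg E x} {x : M}
    (h : ContMDiffAt 𝓘(ℝ, E) (𝓘(ℝ, E).prod 𝓘(ℝ, E →L[ℝ] ℝ)) ∞
      (fun x => TotalSpace.mk' (E →L[ℝ] ℝ) x (α x)) x) :
    ContMDiffAt 𝓘(ℝ, E) (𝓘(ℝ, E).prod 𝓘(ℝ, E × (E →L[ℝ] ℝ))) ∞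
    (fun x => TotalSpace.mk' (E × (E →L[ℝ] ℝ)) (E := fun x => BigTg E x) x (G.φ x (0, α x))) x :=
  ContMDiffAt.clm_bundle_apply (F₁ := E × (E →L[ℝ] ℝ)) (F₂ := E × (E →L[ℝ] ℝ))
    (E₁ := fun x : M => BigTg E x) (E₂ := fun x : M => BigTg E x) (G.smooth x)
    (contMDiffAt_prod_section_iff.2 ⟨smoothField_zero x, h⟩)

theorem smooth_sharp : ContMDiff 𝓘(ℝ, E) (𝓘(ℝ, E).prod 𝓘(ℝ, (E →L[ℝ] ℝ) →L[ℝ] E)) ∞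
    (fun x => TotalSpace.mk' ((E →L[ℝ] ℝ) →L[ℝ] E) (E := fun x => Cotg E x →L[ℝ] Tg E x) x
      (G.sharp x)) := fun _ =>
  contMDiffAt_hom_of_apply (V₁ := fun x : M => Cotg E x) (V₂ := fun x : M => Tg E x) fun α =>
    (contMDiffAt_prod_section_iff.1
      (G.smoothAt_φ_zero (FiberBundle.contMDiffAt_extend 𝓘(ℝ, E) (E →L[ℝ] ℝ) α))).1

theorem smooth_γ : SmoothBilinForm G.γ := fun x =>
  contMDiffAt_hom_inverse (V₁ := fun x : M => Cotg E x) (V₂ := fun x : M => Tg E x)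
    (G.smooth_sharp x) fun _ => sharp_isInvertible

theorem smooth_ψ : SmoothBilinForm G.ψ := fun x =>
  contMDiffAt_hom_of_apply (V₁ := fun x : M => Tg E x) (V₂ := fun x : M => Cotg E x) fun v =>
    (contMDiffAt_prod_section_iff.1 (G.smoothAt_φ_zero
      (ContMDiffAt.clm_bundle_apply (F₁ := E) (F₂ := E →L[ℝ] ℝ)
        (E₁ := fun x : M => Tg E x) (E₂ := fun x : M => Cotg E x) (G.smooth_γ x)
        (FiberBundle.contMDiffAt_extend 𝓘(ℝ, E) E v)))).2

end GenRiemannian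

end SmoothFields

/-! ### Leibniz rules, `dψ`, and tensoriality in the test field -/

section FieldCalculus

variable {E : Type*} [NormedAddCommGroup E] [NormedSpace ℝ E]
  {M : Type*} [TopologicalSpace M] [ChartedSpace E M]

section Rules

variable {X Y Z W : Π x : M, Tg E x} {f g : M → ℝ} {x : M}

theorem dirDeriv_add (hf : MDiffAt f x) (hg : MDiffAt g x) :
    dirDeriv X (fun y => f y + g y) x = dirDeriv X f x + dirDeriv X g x := by
  have := congrArg (fun L => L (X x)) (mvfderiv_add hf hg)
  exact this

theorem dirDeriv_sub (hf : MDiffAt f x) (hg : MDiffAt g x) :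
    dirDeriv X (fun y => f y - g y) x = dirDeriv X f x - dirDeriv X g x := by
  have := congrArg (fun L => L (X x)) (mvfderiv_sub hf hg)
  exact this

theorem dirDeriv_neg : dirDeriv X (fun y => -f y) x = -dirDeriv X f x := by
  have := congrArg (fun L => L (X x)) (mvfderiv_neg (I := 𝓘(ℝ, E)) (g := f) (x := x))
  exact this

theorem dirDeriv_mul (hf : MDiffAt f x) (hg : MDiffAt g x) :
    dirDeriv X (fun y => f y * g y) x = f x * dirDeriv X g x + g x * dirDeriv X f x := by
  have := congrArg (fun L => L (X x)) (mvfderiv_mul hf hg)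
  exact this

theorem dirDeriv_add_left : dirDeriv (X + Y) f x = dirDeriv X f x + dirDeriv Y f x :=
  map_add (mvfderiv 𝓘(ℝ, E) f x) (X x) (Y x)

theorem dirDeriv_smul_left : dirDeriv (g • X) f x = g x * dirDeriv X f x :=
  map_smul (mvfderiv 𝓘(ℝ, E) f x) (g x) (X x)

theorem lie_swap : lie X Y x = -lie Y X x := VectorField.mlieBracket_swap_apply

variable [FiniteDimensional ℝ E] [IsManifold 𝓘(ℝ, E) ∞ M]

theorem lie_add_right (hY : DiffField Y x) (hZ : DiffField Z x) :
    lie X (Y + Z) x = lie X Y x + lie X Z x := VectorField.mlieBracket_add_right hY hZ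

theorem lie_smul_right (hf : MDiffAt f x) (hY : DiffField Y x) :
    lie X (f • Y) x = dirDeriv X f x • Y x + f x • lie X Y x :=
  VectorField.mlieBracket_smul_right hf hY

end Rules

section DTwoForm

variable {ψ : Π x : M, Tg E x →L[ℝ] Cotg E x}

theorem dTwoForm_swap_left (hs : ∀ x v w, ψ x v w = -ψ x w v) (X Y Z : Π x : M, Tg E x) (x : M) :
    dTwoForm ψ X Y Z x = -dTwoForm ψ Y X Z x := by
  have h : dirDeriv Z (fun y => ψ y (X y) (Y y)) x = -dirDeriv Z (fun y => ψ y (Y y) (X y)) x := by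
    rw [← dirDeriv_neg]; simp only [← hs]
  simp only [dTwoForm, h, lie_swap (X := X) (Y := Y), map_neg, neg_apply]
  ring

theorem dTwoForm_swap_right (hs : ∀ x v w, ψ x v w = -ψ x w v) (X Y Z : Π x : M, Tg E x) (x : M) :
    dTwoForm ψ X Y Z x = -dTwoForm ψ X Z Y x := by
  have h : dirDeriv X (fun y => ψ y (Y y) (Z y)) x = -dirDeriv X (fun y => ψ y (Z y) (Y y)) x := by
    rw [← dirDeriv_neg]; simp only [← hs]
  simp only [dTwoForm, h, lie_swap (X := Z) (Y := Y), map_neg, neg_apply]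
  ring

end DTwoForm

variable [FiniteDimensional ℝ E] [IsManifold 𝓘(ℝ, E) ∞ M]

section Tensoriality

variable {X Y : Π x : M, Tg E x} {x : M}

/-- The term `X(f) μ(Z)` of the Leibniz rule cancels against the one from `[X, fZ]`. Tensoriality is
what rules out the default value `0` of `covector`. -/
theorem tensorialAt_lieDerivForm {μ : Π x : M, Cotg E x} (hμ : SmoothForm μ) :
    TensorialAt 𝓘(ℝ, E) E (fun Z => dirDeriv X (fun y => μ y (Z y)) x - μ x (lie X Z x)) x where
  smul {f Z} hf hZ := by
    have h := dirDeriv_mul (X := X) hf (hμ.diff_apply hZ)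
    simp only [Pi.smul_apply', map_smul, smul_eq_mul, lie_smul_right hf hZ, map_add] at h ⊢
    rw [h]
    ring
  add {Z W} hZ hW := by
    have h := dirDeriv_add (X := X) (hμ.diff_apply hZ) (hμ.diff_apply hW)
    simp only [Pi.add_apply, map_add, lie_add_right hZ hW] at h ⊢
    rw [h]
    ring

/-- The derivatives `X(f)` and `Y(f)` cancel against those from `[X, fZ]` and `[Y, fZ]`; symmetry of
`γ` matches the arguments. -/
theorem tensorialAt_koszul {γ : Π x : M, Tg E x →L[ℝ] Cotg E x} (hγ : SmoothBilinForm γ)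
    (hs : ∀ x v w, γ x v w = γ x w v) (hX : DiffField X x) (hY : DiffField Y x) :
    TensorialAt 𝓘(ℝ, E) E (fun Z => koszul γ X Y Z x) x where
  smul {f Z} hf hZ := by
    have h1 := dirDeriv_mul (X := X) hf (hγ.diff_apply hY hZ)
    have h2 := dirDeriv_mul (X := Y) hf (hγ.diff_apply hX hZ)
    simp only [koszul, Pi.smul_apply', map_smul, smul_eq_mul, lie_smul_right hf hZ, map_add,
      dirDeriv_smul_left, h1, h2, add_apply, smul_apply, hs x (Z x)]
    ring
  add {Z W} hZ hW := by
    have h1 := dirDeriv_add (X := X) (hγ.diff_apply hY hZ) (hγ.diff_apply hY hW)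
    have h2 := dirDeriv_add (X := Y) (hγ.diff_apply hX hZ) (hγ.diff_apply hX hW)
    simp only [koszul, Pi.add_apply, map_add, lie_add_right hZ hW, dirDeriv_add_left, h1, h2,
      add_apply]
    ring

/-- The cancellation is that of the Koszul expression, with skewness of `ψ` accounting for the
different signs. -/
theorem tensorialAt_dTwoForm {ψ : Π x : M, Tg E x →L[ℝ] Cotg E x} (hψ : SmoothBilinForm ψ)
    (hs : ∀ x v w, ψ x v w = -ψ x w v) (hX : DiffField X x) (hY : DiffField Y x) :
    TensorialAt 𝓘(ℝ, E) E (fun Z => dTwoForm ψ X Y Z x) x where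
  smul {f Z} hf hZ := by
    have h1 := dirDeriv_mul (X := X) hf (hψ.diff_apply hY hZ)
    have h2 := dirDeriv_mul (X := Y) hf (hψ.diff_apply hX hZ)
    simp only [dTwoForm, Pi.smul_apply', map_smul, smul_eq_mul, lie_smul_right hf hZ, map_add,
      dirDeriv_smul_left, h1, h2, add_apply, smul_apply, hs x (Z x)]
    ring
  add {Z W} hZ hW := by
    have h1 := dirDeriv_add (X := X) (hψ.diff_apply hY hZ) (hψ.diff_apply hY hW)
    have h2 := dirDeriv_add (X := Y) (hψ.diff_apply hX hZ) (hψ.diff_apply hX hW)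
    simp only [dTwoForm, Pi.add_apply, map_add, lie_add_right hZ hW, dirDeriv_add_left, h1, h2,
      add_apply]
    ring

end Tensoriality

theorem covector_dTwoForm {ψ : Π x : M, Tg E x →L[ℝ] Cotg E x} (hψ : SmoothBilinForm ψ)
    (hs : ∀ x v w, ψ x v w = -ψ x w v) {X Y Z : Π x : M, Tg E x}
    (hX : SmoothField X) (hY : SmoothField Y) (hZ : SmoothField Z) (x : M) :
    covector (fun Z => dTwoForm ψ X Y Z x) x (Z x) = dTwoForm ψ X Y Z x :=
  covector_apply (tensorialAt_dTwoForm hψ hs (hX.diff x) (hY.diff x)) (hZ.diff x)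

end FieldCalculus

/-! ### The Levi-Civita connection: metric, torsion-free, additive -/

section LeviCivita

variable {E : Type*} [NormedAddCommGroup E] [NormedSpace ℝ E] [FiniteDimensional ℝ E]
  {M : Type*} [TopologicalSpace M] [ChartedSpace E M] [IsManifold 𝓘(ℝ, E) ∞ M]

namespace GenRiemannian

variable (G : GenRiemannian E M)

/-- On a Hausdorff manifold some global smooth field takes the value `v - w` at `x`; positivity of
`γ` does the rest. This is how formulas known only for smooth test fields give equalities of
vectors. -/
theorem γ_ext [T2Space M] {x : M} {v w : Tg E x}
    (h : ∀ Z : Π x : M, Tg E x, SmoothField Z → G.γ x v (Z x) = G.γ x w (Z x)) : v = w := by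
  obtain ⟨Z, hZ, hZx⟩ := exists_smoothField_eq (v - w)
  by_contra hvw
  have h1 := γ_pos (G := G) (sub_ne_zero.2 hvw)
  have h2 := h Z hZ
  rw [hZx, ← sub_eq_zero, ← sub_apply, ← map_sub] at h2
  exact h1.ne' h2

variable {G} {X Y Z : Π x : M, Tg E x}

/-- The Koszul formula. -/
theorem two_mul_γ_leviCivita (hX : SmoothField X) (hY : SmoothField Y) (hZ : SmoothField Z)
    (x : M) : 2 * G.γ x (leviCivita G.γ X Y x) (Z x) = koszul G.γ X Y Z x := by
  have h := covector_apply (tensorialAt_koszul G.smooth_γ (fun x => γ_symm (G := G) (x := x))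
    (hX.diff x) (hY.diff x)) (hZ.diff x)
  rw [leviCivita, γ_inverse, γ_sharp, smul_apply, h, smul_eq_mul]
  ring

theorem dirDeriv_γ_symm (x : M) : dirDeriv X (fun y => G.γ y (Y y) (Z y)) x
    = dirDeriv X (fun y => G.γ y (Z y) (Y y)) x := by
  simp only [γ_symm (G := G) (Y _)]

/-- The Levi-Civita connection is metric. -/
theorem dirDeriv_γ (hX : SmoothField X) (hY : SmoothField Y) (hZ : SmoothField Z) (x : M) :
    dirDeriv X (fun y => G.γ y (Y y) (Z y)) x
      = G.γ x (leviCivita G.γ X Y x) (Z x) + G.γ x (leviCivita G.γ X Z x) (Y x) := by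
  -- In the sum of the Koszul formulas for `(X, Y, Z)` and `(X, Z, Y)` everything but `2 X(γ(Y, Z))`
  -- cancels.
  have h1 := two_mul_γ_leviCivita (G := G) hX hY hZ x
  have h2 := two_mul_γ_leviCivita (G := G) hX hZ hY x
  simp only [koszul] at h1 h2
  rw [dirDeriv_γ_symm (Y := Z), lie_swap (X := Z), map_neg, neg_apply] at h2
  linarith

/-- The Levi-Civita connection is torsion-free. -/
theorem leviCivita_sub_swap [T2Space M] (hX : SmoothField X) (hY : SmoothField Y) (x : M) :
    leviCivita G.γ X Y x - leviCivita G.γ Y X x = lie X Y x := by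
  refine G.γ_ext fun Z hZ => ?_
  have h1 := two_mul_γ_leviCivita (G := G) hX hY hZ x
  have h2 := two_mul_γ_leviCivita (G := G) hY hX hZ x
  simp only [koszul] at h1 h2
  rw [lie_swap (X := Y) (Y := X), map_neg, neg_apply, dirDeriv_γ_symm (Y := Y) (Z := X)] at h2
  rw [map_sub, sub_apply]
  linarith

theorem leviCivita_add [T2Space M] (hX : SmoothField X) (hY : SmoothField Y)
    (hZ : SmoothField Z) (x : M) :
    leviCivita G.γ X (Y + Z) x = leviCivita G.γ X Y x + leviCivita G.γ X Z x := by
  refine G.γ_ext fun W hW => ?_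
  have h0 := two_mul_γ_leviCivita (G := G) hX (hY.add hZ) hW x
  have h1 := two_mul_γ_leviCivita (G := G) hX hY hW x
  have h2 := two_mul_γ_leviCivita (G := G) hX hZ hW x
  have e1 := dirDeriv_add (X := X) (G.smooth_γ.diff_apply (hY.diff x) (hW.diff x))
    (G.smooth_γ.diff_apply (hZ.diff x) (hW.diff x))
  have e2 := dirDeriv_add (X := W) (G.smooth_γ.diff_apply (hX.diff x) (hY.diff x))
    (G.smooth_γ.diff_apply (hX.diff x) (hZ.diff x))
  have e3 := lie_add_right (X := X) (hY.diff x) (hZ.diff x)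
  have e4 : lie (Y + Z) W x = lie Y W x + lie Z W x := by
    rw [lie_swap, lie_add_right (hY.diff x) (hZ.diff x), neg_add, ← lie_swap, ← lie_swap]
  simp only [koszul, Pi.add_apply, map_add, add_apply, dirDeriv_add_left, e1, e2, e3, e4]
    at h0 h1 h2 ⊢
  linarith

theorem leviCivita_sub [T2Space M] (hX : SmoothField X) (hY : SmoothField Y)
    (hZ : SmoothField Z) (x : M) :
    leviCivita G.γ X (Y - Z) x = leviCivita G.γ X Y x - leviCivita G.γ X Z x := by
  rw [eq_sub_iff_add_eq, ← leviCivita_add hX (hY.sub hZ) hZ, sub_add_cancel]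

theorem leviCivita_zero [T2Space M] (hX : SmoothField X) (x : M) :
    leviCivita G.γ X 0 x = 0 := by
  simpa using leviCivita_sub (G := G) hX hX hX x

theorem γ_torsionConn (s : ℝ) (hX : SmoothField X) (hY : SmoothField Y) (hZ : SmoothField Z)
    (x : M) : G.γ x (torsionConn s G.γ G.ψ X Y x) (Z x) =
      G.γ x (leviCivita G.γ X Y x) (Z x) + s / 2 * dTwoForm G.ψ X Y Z x := by
  rw [torsionConn, map_add, map_smul, γ_inverse, γ_sharp, add_apply, smul_apply, smul_eq_mul,
    covector_dTwoForm G.smooth_ψ (fun x => ψ_skew (G := G) (x := x)) hX hY hZ]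

end GenRiemannian

end LeviCivita

/-! ### The Courant bracket through `D` and `dψ` -/

section Courant

variable {E : Type*} [NormedAddCommGroup E] [NormedSpace ℝ E] [FiniteDimensional ℝ E]
  {M : Type*} [TopologicalSpace M] [ChartedSpace E M] [IsManifold 𝓘(ℝ, E) ∞ M]

/-- Pairing with a vector turns the bracket into scalar derivatives, the Lie derivatives being
evaluated on the smooth field `Z`. -/
theorem neutral_courant {𝒳 𝒴 : Π x : M, BigTg E x} (h𝒳 : SmoothBigField 𝒳)
    (h𝒴 : SmoothBigField 𝒴) {Z : Π x : M, Tg E x} (hZ : SmoothField Z) (x : M) (ζ : Cotg E x) :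
    neutral (courant 𝒳 𝒴 x) (Z x, ζ) =
      dirDeriv (fun y => (𝒳 y).1) (fun y => (𝒴 y).2 (Z y)) x
        - (𝒴 x).2 (lie (fun y => (𝒳 y).1) Z x)
        - (dirDeriv (fun y => (𝒴 y).1) (fun y => (𝒳 y).2 (Z y)) x
          - (𝒳 x).2 (lie (fun y => (𝒴 y).1) Z x))
        + 1 / 2 * dirDeriv Z (fun y => (𝒳 y).2 (𝒴 y).1 - (𝒴 y).2 (𝒳 y).1) x
        + ζ (lie (fun y => (𝒳 y).1) (fun y => (𝒴 y).1) x) := by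
  have h1 := covector_apply (tensorialAt_lieDerivForm (X := fun y => (𝒳 y).1) (x := x)
    (smoothBigField_iff.1 h𝒴).2) (hZ.diff x)
  have h2 := covector_apply (tensorialAt_lieDerivForm (X := fun y => (𝒴 y).1) (x := x)
    (smoothBigField_iff.1 h𝒳).2) (hZ.diff x)
  simp only [neutral, courant, lieDerivForm, add_apply, sub_apply, smul_apply, h1, h2,
    smul_eq_mul]
  rfl

namespace GenRiemannian

variable (G : GenRiemannian E M)

/-- The vector of `TM ⊕ T*M` with components `(P, ♭_{ψ+γ}P)` in `V_+` and `(Q, ♭_{ψ-γ}Q)` in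
`V_-`. -/
def ofComponents (P Q : Π x : M, Tg E x) (x : M) : BigTg E x :=
  (P x + Q x, G.ψ x (P x + Q x) + G.γ x (P x - Q x))

variable {G} {P Q : Π x : M, Tg E x}

omit [FiniteDimensional ℝ E] in
theorem ofComponents_eq (P Q : Π x : M, Tg E x) (x : M) : G.ofComponents P Q x =
    (P x, G.ψ x (P x) + G.γ x (P x)) + (Q x, G.ψ x (Q x) - G.γ x (Q x)) := by
  refine Prod.ext rfl ?_
  change G.ψ x (P x + Q x) + G.γ x (P x - Q x)
    = G.ψ x (P x) + G.γ x (P x) + (G.ψ x (Q x) - G.γ x (Q x))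
  rw [map_add, map_sub]
  abel

theorem smoothBigField_ofComponents (hP : SmoothField P) (hQ : SmoothField Q) :
    SmoothBigField (G.ofComponents P Q) :=
  smoothBigField_iff.2 ⟨hP.add hQ,
    (G.smooth_ψ.apply (hP.add hQ)).add (G.smooth_γ.apply (hP.sub hQ))⟩

theorem exists_ofComponents {𝒳 : Π x : M, BigTg E x} (h : SmoothBigField 𝒳) :
    ∃ P Q : Π x : M, Tg E x, SmoothField P ∧ SmoothField Q ∧ 𝒳 = G.ofComponents P Q := by
  have hc : ∀ {X : Π x : M, Tg E x}, SmoothField X → SmoothField ((1 / 2 : ℝ) • X) :=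
    fun h => ContMDiff.const_smul_section h
  have h1 := (smoothBigField_iff.1 h).1
  have h2 := (smoothBigField_iff.1 (G.smooth.apply h)).1
  -- The components are the tangent parts of `(1/2)(𝒳 ± φ𝒳)`. Their difference is the tangent part
  -- of `φ𝒳`, which `γ` sends to `𝒳.2 - ψ(𝒳.1)`.
  refine ⟨_, _, hc (h1.add h2), hc (h1.sub h2), funext fun x => ?_⟩
  have e1 : (1 / 2 : ℝ) • ((𝒳 x).1 + (G.φ x (𝒳 x)).1)
      + (1 / 2 : ℝ) • ((𝒳 x).1 - (G.φ x (𝒳 x)).1) = (𝒳 x).1 := by module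
  have e2 : (1 / 2 : ℝ) • ((𝒳 x).1 + (G.φ x (𝒳 x)).1)
      - (1 / 2 : ℝ) • ((𝒳 x).1 - (G.φ x (𝒳 x)).1) = (G.φ x (𝒳 x)).1 := by module
  have e3 : G.γ x (G.φ x (𝒳 x)).1 = (𝒳 x).2 - G.ψ x (𝒳 x).1 := by
    rw [φ_apply, γ_sharp]
  refine Prod.ext e1.symm ?_
  simp only [ofComponents, Pi.smul_apply, Pi.add_apply, Pi.sub_apply]
  rw [e1, e2, e3]
  abel

variable [T2Space M]

/-- The Courant bracket in terms of the Levi-Civita connection and `dψ`. -/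
theorem neutral_courant_graph {X Y Z A B C : Π x : M, Tg E x} (hX : SmoothField X)
    (hY : SmoothField Y) (hZ : SmoothField Z) (hA : SmoothField A) (hB : SmoothField B) (x : M) :
    neutral (courant (fun y => (X y, G.ψ y (X y) + G.γ y (A y)))
        (fun y => (Y y, G.ψ y (Y y) + G.γ y (B y))) x) (Z x, G.ψ x (Z x) + G.γ x (C x)) =
      dTwoForm G.ψ X Y Z x
        + G.γ x (leviCivita G.γ X Y x - leviCivita G.γ Y X x) (C x)
        + G.γ x (leviCivita G.γ X B x - leviCivita G.γ Y A x) (Z x)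
        + 1 / 2 * (G.γ x (leviCivita G.γ Z X x) (B x) - G.γ x (leviCivita G.γ Z Y x) (A x)
          + G.γ x (leviCivita G.γ Z A x) (Y x) - G.γ x (leviCivita G.γ Z B x) (X x)) := by
  have bil : ∀ {X A : Π x : M, Tg E x}, SmoothField X → SmoothField A →
      SmoothBigField (fun y => (X y, G.ψ y (X y) + G.γ y (A y))) := fun hX hA =>
    smoothBigField_iff.2 ⟨hX, (G.smooth_ψ.apply hX).add (G.smooth_γ.apply hA)⟩
  rw [neutral_courant (bil hX hA) (bil hY hB) hZ]
  have dψ : ∀ {X Y : Π x : M, Tg E x}, SmoothField X → SmoothField Y →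
      MDiffAt (fun y => G.ψ y (X y) (Y y)) x := fun hX hY =>
    G.smooth_ψ.diff_apply (hX.diff x) (hY.diff x)
  have dγ : ∀ {X Y : Π x : M, Tg E x}, SmoothField X → SmoothField Y →
      MDiffAt (fun y => G.γ y (X y) (Y y)) x := fun hX hY =>
    G.smooth_γ.diff_apply (hX.diff x) (hY.diff x)
  have e1 := dirDeriv_add (X := X) (dψ hY hZ) (dγ hB hZ)
  have e2 := dirDeriv_add (X := Y) (dψ hX hZ) (dγ hA hZ)
  have dα : ∀ {X Y A : Π x : M, Tg E x}, SmoothField X → SmoothField Y → SmoothField A →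
      MDiffAt (fun y => G.ψ y (X y) (Y y) + G.γ y (A y) (Y y)) x := fun hX hY hA =>
    (dψ hX hY).add (dγ hA hY)
  have e3 := dirDeriv_sub (X := Z) (dα hX hY hA) (dα hY hX hB)
  have e4 := dirDeriv_add (X := Z) (dψ hX hY) (dγ hA hY)
  have e5 := dirDeriv_add (X := Z) (dψ hY hX) (dγ hB hX)
  -- By skewness the factor `1/2` in the bracket yields the whole term `Z(ψ(X, Y))` of `dψ`. The
  -- term `-ψ([X, Y], Z)` comes from the part `ψ Z` of the test covector.
  have e6 : dirDeriv Z (fun y => G.ψ y (Y y) (X y)) x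
      = -dirDeriv Z (fun y => G.ψ y (X y) (Y y)) x := by
    rw [← dirDeriv_neg]; simp only [← ψ_skew (G := G)]
  have m1 := dirDeriv_γ (G := G) hX hB hZ x
  have m2 := dirDeriv_γ (G := G) hY hA hZ x
  have m3 := dirDeriv_γ (G := G) hZ hA hY x
  have m4 := dirDeriv_γ (G := G) hZ hB hX x
  have s1 := ψ_skew (G := G) (x := x) (lie X Y x) (Z x)
  have s2 := ψ_skew (G := G) (x := x) (lie X Z x) (Y x)
  have s3 := ψ_skew (G := G) (x := x) (lie Y Z x) (X x)
  have s4 := γ_symm (G := G) (x := x) (C x) (lie X Y x)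
  have s5 := γ_symm (G := G) (x := x) (B x) (lie X Z x)
  have s6 := γ_symm (G := G) (x := x) (A x) (lie Y Z x)
  have t1 := leviCivita_sub_swap (G := G) hX hY x
  have t2 := leviCivita_sub_swap (G := G) hX hZ x
  have t3 := leviCivita_sub_swap (G := G) hY hZ x
  replace t2 := congrArg (fun v => G.γ x v (B x)) t2
  replace t3 := congrArg (fun v => G.γ x v (A x)) t3
  simp only [map_sub, sub_apply] at t2 t3
  simp only [add_apply, t1]
  rw [e1, e2, e3, e4, e5]
  simp only [dTwoForm, map_sub, sub_apply]
  linarith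

end GenRiemannian

end Courant

/-! ### Component form of bracket, connection and `Ψ`; the equivalence -/

section Parallel

variable {E : Type*} [NormedAddCommGroup E] [NormedSpace ℝ E] [FiniteDimensional ℝ E]
  {M : Type*} [TopologicalSpace M] [ChartedSpace E M] [IsManifold 𝓘(ℝ, E) ∞ M]

namespace GenRiemannian

variable {G : GenRiemannian E M}

/-- The Courant bracket of sections given by their components in `V_+` and `V_-`. -/
theorem neutral_courant_ofComponents [T2Space M] {P₁ Q₁ P₂ Q₂ P₃ Q₃ : Π x : M, Tg E x}
    (hP₁ : SmoothField P₁) (hQ₁ : SmoothField Q₁) (hP₂ : SmoothField P₂) (hQ₂ : SmoothField Q₂)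
    (hP₃ : SmoothField P₃) (hQ₃ : SmoothField Q₃) (x : M) :
    neutral (courant (G.ofComponents P₁ Q₁) (G.ofComponents P₂ Q₂) x) (G.ofComponents P₃ Q₃ x) =
      dTwoForm G.ψ (P₁ + Q₁) (P₂ + Q₂) (P₃ + Q₃) x
        + 2 * (G.γ x (leviCivita G.γ (P₁ + Q₁) P₂ x) (P₃ x)
          - G.γ x (leviCivita G.γ (P₂ + Q₂) P₁ x) (P₃ x))
        - 2 * (G.γ x (leviCivita G.γ (P₁ + Q₁) Q₂ x) (Q₃ x)
          - G.γ x (leviCivita G.γ (P₂ + Q₂) Q₁ x) (Q₃ x))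
        + (G.γ x (leviCivita G.γ (P₃ + Q₃) P₁ x) (P₂ x)
          - G.γ x (leviCivita G.γ (P₃ + Q₃) P₂ x) (P₁ x))
        - (G.γ x (leviCivita G.γ (P₃ + Q₃) Q₁ x) (Q₂ x)
          - G.γ x (leviCivita G.γ (P₃ + Q₃) Q₂ x) (Q₁ x)) := by
  -- Components `(P, Q)` have tangent part `P + Q` and `γ`-part `P - Q`, so products mixing a `P`
  -- with a `Q` cancel on expansion.
  have h := neutral_courant_graph (G := G) (C := P₃ - Q₃) (hP₁.add hQ₁) (hP₂.add hQ₂)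
    (hP₃.add hQ₃) (hP₁.sub hQ₁) (hP₂.sub hQ₂) x
  refine Eq.trans h ?_
  rw [leviCivita_add (hP₁.add hQ₁) hP₂ hQ₂, leviCivita_add (hP₂.add hQ₂) hP₁ hQ₁,
    leviCivita_sub (hP₁.add hQ₁) hP₂ hQ₂, leviCivita_sub (hP₂.add hQ₂) hP₁ hQ₁,
    leviCivita_add (hP₃.add hQ₃) hP₂ hQ₂, leviCivita_add (hP₃.add hQ₃) hP₁ hQ₁,
    leviCivita_sub (hP₃.add hQ₃) hP₂ hQ₂, leviCivita_sub (hP₃.add hQ₃) hP₁ hQ₁]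
  simp only [map_add, map_sub, add_apply, sub_apply, Pi.add_apply, Pi.sub_apply]
  ring

/-- The projections `(1/2)(Id ± φ)` in the definition of `canonicalConn` recover exactly the fields
`P` and `Q`. -/
theorem canonicalConn_ofComponents (X P Q : Π x : M, Tg E x) (x : M) :
    G.canonicalConn X (G.ofComponents P Q) x =
      (torsionConn 1 G.γ G.ψ X P x, G.ψ x (torsionConn 1 G.γ G.ψ X P x)
        + G.γ x (torsionConn 1 G.γ G.ψ X P x)) +
      (torsionConn (-1) G.γ G.ψ X Q x, G.ψ x (torsionConn (-1) G.γ G.ψ X Q x)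
        - G.γ x (torsionConn (-1) G.γ G.ψ X Q x)) := by
  have h : ∀ y, (G.φ y (G.ofComponents P Q y)).1 = P y - Q y := fun y => by
    rw [φ_apply]
    simp only [ofComponents, add_sub_cancel_left, sharp_γ]
  have h1 : (fun y => ((1 / 2 : ℝ) • (G.ofComponents P Q y
      + G.φ y (G.ofComponents P Q y))).1) = P := funext fun y => by
    simp only [Prod.smul_fst, Prod.fst_add, h]
    simp only [ofComponents]
    module
  have h2 : (fun y => ((1 / 2 : ℝ) • (G.ofComponents P Q y
      - G.φ y (G.ofComponents P Q y))).1) = Q := funext fun y => by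
    simp only [Prod.smul_fst, Prod.fst_sub, h]
    simp only [ofComponents]
    module
  simp only [canonicalConn, h1, h2]

-- Nondegeneracy of `g` follows from positivity of `G`: take `v = φ w`.
omit [FiniteDimensional ℝ E] in
theorem neutral_eq_zero (G : GenRiemannian E M) {x : M} {w : BigTg E x}
    (h : ∀ v, neutral w v = 0) : w = 0 := by
  by_contra hw
  have h1 := G.pos x w hw
  rw [neutral_φ_comm, h] at h1
  exact lt_irrefl _ h1

end GenRiemannian

namespace AlmostParaHermitian

open GenRiemannian

variable {G : GenRiemannian E M} {P : AlmostParaHermitian G}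

theorem Ψ_graph_F {x : M} (X : Tg E x) :
    P.Ψ x (P.F x X, G.ψ x (P.F x X) - G.γ x (P.F x X)) = (X, G.ψ x X + G.γ x X) := by
  rw [← Ψ_graph, P.Ψ_sq]

theorem smoothField_F {X : Π x : M, Tg E x} (hX : SmoothField X) :
    SmoothField (fun x => P.F x (X x)) :=
  (smoothBigField_iff.1 (P.smooth.apply (smoothBigField_iff.2 ⟨hX,
    (G.smooth_ψ.apply hX).add (G.smooth_γ.apply hX)⟩))).1

/-- In terms of the identification `(X, Y) ↦ (X, ♭_{ψ+γ}X) + (FY, ♭_{ψ-γ}FY)`, the endomorphism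
`Ψ` interchanges the two components. -/
theorem Ψ_ofComponents (X Y : Π x : M, Tg E x) (x : M) :
    P.Ψ x (G.ofComponents X (fun y => P.F y (Y y)) x)
      = G.ofComponents Y (fun y => P.F y (X y)) x := by
  rw [ofComponents_eq, ofComponents_eq, ContinuousLinearMap.map_add, Ψ_graph, Ψ_graph_F, add_comm]

theorem exists_ofComponents_F {𝒳 : Π x : M, BigTg E x} (h : SmoothBigField 𝒳) :
    ∃ X Y : Π x : M, Tg E x, SmoothField X ∧ SmoothField Y ∧
      𝒳 = G.ofComponents X (fun y => P.F y (Y y)) := by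
  obtain ⟨X, Q, hX, hQ, rfl⟩ := exists_ofComponents (G := G) h
  -- `Ψ` anticommutes with `φ`, so it maps `V_-` to `V_+`. The tangent part of the image of `(Q,
  -- ♭_{ψ-γ}Q)` serves as `F⁻¹Q`, and it is smooth because `Ψ` is.
  have hΨ : ∀ x, P.Ψ x (Q x, G.ψ x (Q x) - G.γ x (Q x)) =
      ((P.Ψ x (Q x, G.ψ x (Q x) - G.γ x (Q x))).1,
        G.ψ x (P.Ψ x (Q x, G.ψ x (Q x) - G.γ x (Q x))).1
        + G.γ x (P.Ψ x (Q x, G.ψ x (Q x) - G.γ x (Q x))).1) := fun x => by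
    refine Prod.ext rfl ((mem_Vplus_iff _).1 ?_)
    rw [φ_Ψ, (mem_Vminus_iff (Q x, G.ψ x (Q x) - G.γ x (Q x))).2 rfl,
      ContinuousLinearMap.map_neg, neg_neg]
  refine ⟨X, fun x => (P.Ψ x (Q x, G.ψ x (Q x) - G.γ x (Q x))).1, hX, ?_, ?_⟩
  · exact (smoothBigField_iff.1 (P.smooth.apply (smoothBigField_iff.2 ⟨hQ,
      (G.smooth_ψ.apply hQ).sub (G.smooth_γ.apply hQ)⟩))).1
  · congr 1
    funext x
    have := congrArg (P.Ψ x) (hΨ x)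
    rw [P.Ψ_sq, Ψ_graph] at this
    exact congrArg Prod.fst this

/-- The integrability tensor paired with a third section. -/
theorem neutral_nijenhuis (𝒳 𝒴 : Π x : M, BigTg E x) (x : M) (w : BigTg E x) :
    neutral (nijenhuis P.Ψ 𝒳 𝒴 x) w =
      neutral (courant (fun y => P.Ψ y (𝒳 y)) (fun y => P.Ψ y (𝒴 y)) x) w
        + neutral (courant 𝒳 (fun y => P.Ψ y (𝒴 y)) x) (P.Ψ x w)
        + neutral (courant (fun y => P.Ψ y (𝒳 y)) 𝒴 x) (P.Ψ x w)
        + neutral (courant 𝒳 𝒴 x) w := by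
  -- Skewness moves the outer `Ψ` onto the test vector and turns the two minus signs into plus
  -- signs.
  have h1 := P.skew x (courant 𝒳 (fun y => P.Ψ y (𝒴 y)) x) w
  have h2 := P.skew x (courant (fun y => P.Ψ y (𝒳 y)) 𝒴 x) w
  have hadd : ∀ a b v : BigTg E x, neutral (a + b) v = neutral a v + neutral b v := by
    intro a b v
    simp [neutral]; ring
  have hsub : ∀ a b v : BigTg E x, neutral (a - b) v = neutral a v - neutral b v := by
    intro a b v
    simp [neutral]; ring
  rw [nijenhuis, P.Ψ_sq, hadd, hsub, hsub]
  linarith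

/-- `Ψ` commutes with the canonical big connection iff `F` intertwines `D^+` and `D^-`. -/
theorem commutesWithCanonicalConn_iff : P.CommutesWithCanonicalConn ↔
    ∀ X Y : Π x : M, Tg E x, SmoothField X → SmoothField Y → ∀ x : M,
      torsionConn (-1) G.γ G.ψ X (fun y => P.F y (Y y)) x
        = P.F x (torsionConn 1 G.γ G.ψ X Y x) := by
  constructor
  · intro h X Y hX hY x
    -- Sections of `V_+` already give the intertwining relation.
    have h1 := h X (fun y => (Y y, G.ψ y (Y y) + G.γ y (Y y))) hX (smoothBigField_iff.2 ⟨hY,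
      (G.smooth_ψ.apply hY).add (G.smooth_γ.apply hY)⟩) x
    simp only [Ψ_graph, canonicalConn_minus, canonicalConn_plus] at h1
    exact congrArg Prod.fst h1
  · intro h X 𝒴 hX h𝒴 x
    obtain ⟨Y, Z, hY, hZ, rfl⟩ := exists_ofComponents_F (P := P) h𝒴
    simp only [Ψ_ofComponents]
    have e : (fun y => G.ofComponents Z (fun y => P.F y (Y y)) y)
      = G.ofComponents Z (fun y => P.F y (Y y)) := rfl
    rw [e, canonicalConn_ofComponents, canonicalConn_ofComponents, h X Y hX hY, h X Z hX hZ,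
      ContinuousLinearMap.map_add, Ψ_graph, Ψ_graph_F, add_comm]

variable [T2Space M]

/-- On `V_+` the integrability tensor of an endomorphism that commutes with the canonical big
connection is `-2 dψ`. -/
theorem neutral_nijenhuis_plus (h : P.CommutesWithCanonicalConn) {X Y Z : Π x : M, Tg E x}
    (hX : SmoothField X) (hY : SmoothField Y) (hZ : SmoothField Z) (x : M) :
    neutral (nijenhuis P.Ψ (G.ofComponents X 0) (G.ofComponents Y 0) x) (G.ofComponents Z 0 x)
      = -2 * dTwoForm G.ψ X Y Z x := by
  have hΨ : ∀ (X : Π x : M, Tg E x) (y : M), P.Ψ y (G.ofComponents X 0 y) =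
      G.ofComponents 0 (fun y => P.F y (X y)) y := fun X y => by
    -- The zero component has to be presented as `F 0` for the swapping rule to apply.
    have h0 : (0 : Π x : M, Tg E x) = fun y => P.F y ((0 : Π x : M, Tg E x) y) :=
      funext fun y => (map_zero (P.F y)).symm
    conv_lhs => rw [h0]
    exact Ψ_ofComponents X 0 y
  -- Since `F` is an isometry, pairing `D^-_X(FY) = F(D^+_X Y)` with `FZ` expresses the failure of
  -- `F` to be parallel through `dψ`.
  have key : ∀ {X Y Z : Π x : M, Tg E x}, SmoothField X → SmoothField Y → SmoothField Z →
      G.γ x (leviCivita G.γ X (fun y => P.F y (Y y)) x) (P.F x (Z x)) =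
        G.γ x (leviCivita G.γ X Y x) (Z x)
          + 1 / 2 * (dTwoForm G.ψ X (fun y => P.F y (Y y)) (fun y => P.F y (Z y)) x
            + dTwoForm G.ψ X Y Z x) := fun {X Y Z} hX hY hZ => by
    have h1 := γ_torsionConn (G := G) (-1) hX (smoothField_F (P := P) hY)
      (smoothField_F (P := P) hZ) x
    have h2 := γ_torsionConn (G := G) 1 hX hY hZ x
    rw [commutesWithCanonicalConn_iff.1 h X Y hX hY x, F_isometry] at h1
    linarith
  have h0 : SmoothField (0 : Π x : M, Tg E x) := smoothField_zero
  have hX' := smoothField_F (P := P) hX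
  have hY' := smoothField_F (P := P) hY
  have hZ' := smoothField_F (P := P) hZ
  have hl := dTwoForm_swap_left (fun x => ψ_skew (G := G) (x := x))
  have hr := dTwoForm_swap_right (fun x => ψ_skew (G := G) (x := x))
  have k1 := key hZ hX hY
  have k2 := key hZ hY hX
  have k3 := key hX hY hZ
  have k4 := key hY hX hZ
  rw [neutral_nijenhuis]
  simp only [hΨ]
  have c1 := neutral_courant_ofComponents (G := G) h0 hX' h0 hY' hZ h0 x
  have c2 := neutral_courant_ofComponents (G := G) hX h0 h0 hY' h0 hZ' x
  have c3 := neutral_courant_ofComponents (G := G) h0 hX' hY h0 h0 hZ' x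
  have c4 := neutral_courant_ofComponents (G := G) hX h0 hY h0 hZ h0 x
  simp only [add_zero, zero_add, leviCivita_zero hX, leviCivita_zero hY, leviCivita_zero hZ,
    leviCivita_zero hX', leviCivita_zero hY', leviCivita_zero hZ', map_zero, zero_apply,
    Pi.zero_apply] at c1 c2 c3 c4
  have e1 := hr Z (fun y => P.F y (X y)) (fun y => P.F y (Y y)) x
  have e2 := hl Z (fun y => P.F y (X y)) (fun y => P.F y (Y y)) x
  have e3 := hr (fun y => P.F y (X y)) Z (fun y => P.F y (Y y)) x
  have e4 := hr Z X Y x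
  have e5 := hl Z X Y x
  have e6 := hr X Z Y x
  have e7 := hl Y (fun y => P.F y (X y)) (fun y => P.F y (Z y)) x
  have e8 := hl Y X Z x
  -- After substituting `k1`–`k4` the `γ` terms and the values of `dψ` involving `F` cancel. The
  -- first three brackets leave `-dψ(X,Y,Z)` each and the last one `+dψ(X,Y,Z)`, whence the factor
  -- `-2`.
  refine (congrArg₂ (· + ·) (congrArg₂ (· + ·) (congrArg₂ (· + ·) c1 c2) c3) c4).trans ?_
  linarith

theorem isIntegrable_of_parallel (hψ : IsClosedTwoForm G.ψ)
    (hF : IsLeviCivitaParallel G.γ P.F) : P.IsIntegrable := by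
  intro 𝒳 𝒴 h𝒳 h𝒴 x
  refine G.neutral_eq_zero fun w => ?_
  -- The bracket formula differentiates along the third argument too, so the test vector must be the
  -- value of a smooth section.
  obtain ⟨𝒵, h𝒵, rfl⟩ := exists_contMDiff_section_eq (EB := E) (F₁ := E × (E →L[ℝ] ℝ))
    (V₁ := fun x : M => BigTg E x) w
  obtain ⟨X₁, Y₁, hX₁, hY₁, rfl⟩ := exists_ofComponents_F (P := P) h𝒳
  obtain ⟨X₂, Y₂, hX₂, hY₂, rfl⟩ := exists_ofComponents_F (P := P) h𝒴
  obtain ⟨X₃, Y₃, hX₃, hY₃, rfl⟩ := exists_ofComponents_F (P := P) (𝒳 := 𝒵) h𝒵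
  -- With `dψ = 0` and `DF = 0`, the isometry removes `F` from all products; it survives only in the
  -- directions `Xᵢ + F Yᵢ`.
  have bracket : ∀ {X₁ Y₁ X₂ Y₂ X₃ Y₃ : Π x : M, Tg E x}, SmoothField X₁ → SmoothField Y₁ →
      SmoothField X₂ → SmoothField Y₂ → SmoothField X₃ → SmoothField Y₃ →
      neutral (courant (G.ofComponents X₁ (fun y => P.F y (Y₁ y)))
          (G.ofComponents X₂ (fun y => P.F y (Y₂ y))) x)
          (G.ofComponents X₃ (fun y => P.F y (Y₃ y)) x) =
        2 * (G.γ x (leviCivita G.γ (X₁ + fun y => P.F y (Y₁ y)) X₂ x) (X₃ x)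
          - G.γ x (leviCivita G.γ (X₂ + fun y => P.F y (Y₂ y)) X₁ x) (X₃ x))
        - 2 * (G.γ x (leviCivita G.γ (X₁ + fun y => P.F y (Y₁ y)) Y₂ x) (Y₃ x)
          - G.γ x (leviCivita G.γ (X₂ + fun y => P.F y (Y₂ y)) Y₁ x) (Y₃ x))
        + (G.γ x (leviCivita G.γ (X₃ + fun y => P.F y (Y₃ y)) X₁ x) (X₂ x)
          - G.γ x (leviCivita G.γ (X₃ + fun y => P.F y (Y₃ y)) X₂ x) (X₁ x))
        - (G.γ x (leviCivita G.γ (X₃ + fun y => P.F y (Y₃ y)) Y₁ x) (Y₂ x)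
          - G.γ x (leviCivita G.γ (X₃ + fun y => P.F y (Y₃ y)) Y₂ x) (Y₁ x)) := by
    intro X₁ Y₁ X₂ Y₂ X₃ Y₃ hX₁ hY₁ hX₂ hY₂ hX₃ hY₃
    have s₁ := hX₁.add (smoothField_F (P := P) hY₁)
    have s₂ := hX₂.add (smoothField_F (P := P) hY₂)
    have s₃ := hX₃.add (smoothField_F (P := P) hY₃)
    rw [neutral_courant_ofComponents hX₁ (smoothField_F hY₁) hX₂ (smoothField_F hY₂) hX₃
      (smoothField_F hY₃), hψ _ _ _ s₁ s₂ s₃, hF _ _ s₁ hY₂, hF _ _ s₂ hY₁, hF _ _ s₃ hY₁,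
      hF _ _ s₃ hY₂]
    simp only [F_isometry]
    ring
  have hΨ : ∀ X Y : Π x : M, Tg E x,
      (fun y => P.Ψ y (G.ofComponents X (fun y => P.F y (Y y)) y))
        = G.ofComponents Y (fun y => P.F y (X y)) := fun X Y => funext (Ψ_ofComponents X Y)
  -- Swapping the entries of two sections reverses the sign of the terms differentiated along the
  -- remaining one. Each direction of differentiation occurs in two of the four brackets, with
  -- opposite signs.
  rw [neutral_nijenhuis, hΨ, hΨ, Ψ_ofComponents, bracket hY₁ hX₁ hY₂ hX₂ hX₃ hY₃,
    bracket hX₁ hY₁ hY₂ hX₂ hY₃ hX₃, bracket hY₁ hX₁ hX₂ hY₂ hY₃ hX₃,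
    bracket hX₁ hY₁ hX₂ hY₂ hX₃ hY₃]
  ring

end AlmostParaHermitian

/-- Closedness is a condition on smooth fields only, so the torsion term is seen to vanish by
testing with smooth `Z`. -/
theorem torsionConn_of_closed [T2Space M] {G : GenRiemannian E M} (hψ : IsClosedTwoForm G.ψ)
    (s : ℝ) {X Y : Π x : M, Tg E x} (hX : SmoothField X) (hY : SmoothField Y) (x : M) :
    torsionConn s G.γ G.ψ X Y x = leviCivita G.γ X Y x := by
  refine G.γ_ext fun Z hZ => ?_
  rw [GenRiemannian.γ_torsionConn s hX hY hZ, hψ X Y Z hX hY hZ, mul_zero, add_zero]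

/-- `(G, Ψ)` is parallel iff `dψ = 0` and `F` is parallel for the Levi-Civita connection. -/
theorem AlmostParaHermitian.isParallel_iff [T2Space M] {G : GenRiemannian E M}
    (P : AlmostParaHermitian G) :
    P.IsParallel ↔ IsClosedTwoForm G.ψ ∧ IsLeviCivitaParallel G.γ P.F := by
  constructor
  · rintro ⟨hI, hC⟩
    have hψ : IsClosedTwoForm G.ψ := fun X Y Z hX hY hZ x => by
      -- Only the torsion on sections of `V_+` is needed to obtain `dψ = 0`.
      have h := AlmostParaHermitian.neutral_nijenhuis_plus hC hX hY hZ x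
      rw [hI _ _ (GenRiemannian.smoothBigField_ofComponents hX smoothField_zero)
        (GenRiemannian.smoothBigField_ofComponents hY smoothField_zero)] at h
      simp only [neutral, Prod.fst_zero, Prod.snd_zero, map_zero, zero_apply] at h
      linarith
    refine ⟨hψ, fun X Y hX hY x => ?_⟩
    have h := AlmostParaHermitian.commutesWithCanonicalConn_iff.1 hC X Y hX hY x
    rwa [torsionConn_of_closed hψ _ hX (AlmostParaHermitian.smoothField_F hY),
      torsionConn_of_closed hψ _ hX hY] at h
  · rintro ⟨hψ, hF⟩
    refine ⟨AlmostParaHermitian.isIntegrable_of_parallel hψ hF,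
      AlmostParaHermitian.commutesWithCanonicalConn_iff.2 fun X Y hX hY x => ?_⟩
    rw [torsionConn_of_closed hψ _ hX (AlmostParaHermitian.smoothField_F hY),
      torsionConn_of_closed hψ _ hX hY]
    exact hF X Y hX hY x

end Parallel

end GeneralizedGeometry

end

theorem proposition3p3 {E : Type*} [NormedAddCommGroup E] [NormedSpace ℝ E]
    [FiniteDimensional ℝ E] {M : Type*} [TopologicalSpace M] [T2Space M] [ChartedSpace E M]
    [IsManifold 𝓘(ℝ, E) ∞ M] (G : GeneralizedGeometry.GenRiemannian E M)
    (P : GeneralizedGeometry.AlmostParaHermitian G) :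
    P.IsParallel ↔ GeneralizedGeometry.IsClosedTwoForm G.ψ ∧
      GeneralizedGeometry.IsLeviCivitaParallel G.γ P.F :=
  P.isParallel_iff
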